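/- Let $\Bbbk$ be an algebraically closed field of characteristic $0$, let $V$ be a finite-dimensional $\Bbbk$-vector space with dual $V^\vee$, let $S=\operatorname{Sym}(V)$, and let $K\subseteq\bigwedge^2V$ be a linear subspace. The Koszul module $W(V,K)$ is the graded $S$-module given by the middle homology of $$K\otimes S\xrightarrow{\ \delta_2\ }V\otimes S(1)\xrightarrow{\ \delta_1\ }S(2),\qquad \delta_2(a\wedge b\otimes f)=b\otimes af-a\otimes bf,\quad \delta_1(v\otimes f)=vf,$$ so that $W_q(V,K)$ consists of the classes of the elements of $\ker\delta_1\cap (V\otimes\operatorname{Sym}^{q+1}V)$. Via $\delta_2$ it is identified with the cokernel of $(\bigwedge^3V\oplus K)\otimes S\to\bigwedge^2V\otimes S$, given by the Koszul differential $\delta_3$ and the inclusion of $K$. Let $K^\perp\subseteq\bigwedge^2V^\vee$ be the annihilator of $K$, and let $$\mathcal R(V,K)=\{a\in V^\vee : \text{there is } b\in V^\vee\text{ with } a\wedge b\in K^\perp\setminus\{0\}\}\cup\{0\}$$ be the resonance variety. Assume that $W(V,K)$ is separable: each irreducible component of $\mathcal R(V,K)$ (in the Zariski topology of $V^\vee$)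 is a linear subspace $U\subseteq V^\vee$, and satisfies $K^\perp\cap\langle U\rangle_E\subseteq\bigwedge^2U$, where $\langle U\rangle_E$ is the ideal generated by $U$ in the exterior algebra $E=\bigwedge V^\vee$. Let $\overline V_1^\vee,\dots,\overline V_n^\vee$ be the irreducible components of $\mathcal R(V,K)$ (there are finitely many). Let $\pi_t\colon V\twoheadrightarrow\overline V_t$ be the projection dual to the inclusion $\overline V_t^\vee\subseteq V^\vee$, let $\overline K_t=(\bigwedge^2\pi_t)(K)\subseteq\bigwedge^2\overline V_t$, and let $\widetilde W(\overline V_t,\overline K_t)$ be the graded $S$-module given by the cokernel of the composition $$\Bigl(\bigwedge\nolimits^3V\oplus K\Bigr)\otimes S\to\bigwedge\nolimits^2V\otimes S\xrightarrow{\ \bigwedge^2\pi_t\otimes\mathrm{id}\ }\bigwedge\nolimits^2\overline V_t\otimes S .$$ Then the natural map of graded $S$-modules $$\Pi\colon W(V,K)\to\bigoplus_{t=1}^n\widetilde W(\overline V_t,\overline K_t)$$ induced by the maps $\bigwedge^2\pi_t\otimes\mathrm{id}$ is an isomorphism in all sufficiently large degrees, and $$\dim_{\Bbbk}W_q(V,K)=\sum_{t=1}^n\dim_{\Bbbk}W_q(\overline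 V_t,\overline K_t)\qquad\text{for all } q\gg0 .$$ -/

import Mathlib

open scoped TensorProduct

noncomputable section

namespace Koszul

/-! ### Symmetric algebra and the Koszul complex

`V` is a vector space over `k` and `S = Sym V`. For a vector space `M`, the free `S`-module
written `M ⊗ S` in the literature is `S ⊗[k] M` here. -/

section KoszulComplex

variable (k : Type*) [Field k] (V : Type*) [AddCommGroup V] [Module k V]

/-- The symmetric algebra `S = Sym V`. -/
abbrev S := SymmetricAlgebra k V

/-- The symmetric power `Sym^q V`: the subspace of `Sym V` spanned by `q`-fold products of elements
of `V`. -/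
def symPow (q : ℕ) : Submodule k (S k V) :=
  LinearMap.range (SymmetricAlgebra.ι k V) ^ q

/-- The subspace `M ⊗ Sym^q V` of `M ⊗ S`. -/
def symPart (M : Type*) [AddCommGroup M] [Module k M] (q : ℕ) : Submodule k (S k V ⊗[k] M) :=
  LinearMap.range ((symPow k V q).subtype.rTensor M)

/-- The multiplication map `δ₁ : V ⊗ S → S`, `v ⊗ f ↦ v f`. -/
def d1 : S k V ⊗[k] V →ₗ[S k V] S k V :=
  (SymmetricAlgebra.ι k V).liftBaseChange (S k V)

variable {k V} in
/-- The map `v ↦ (w₁, …, wₙ) ↦ v ⊗ (w₁ ∧ ⋯ ∧ wₙ)`, whose alternatization is the Koszul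
differential. -/
def dGen (n : ℕ) : V →ₗ[k] V [⋀^Fin n]→ₗ[k] (S k V ⊗[k] (⋀[k]^n V)) :=
  { toFun := fun v => (TensorProduct.mk k (S k V) (⋀[k]^n V)
      (SymmetricAlgebra.ι k V v)).compAlternatingMap (exteriorPower.ιMulti k n)
    map_add' := fun v w => by ext; simp
    map_smul' := fun c v => by ext; simp [TensorProduct.smul_tmul'] }

/-- The Koszul differential `⋀ⁿ⁺¹ V ⊗ S → ⋀ⁿ V ⊗ S`,
`v₀ ∧ ⋯ ∧ vₙ ⊗ f ↦ ∑ᵢ (-1)ⁱ (v₀ ∧ ⋯ v̂ᵢ ⋯ ∧ vₙ) ⊗ vᵢ f`. -/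
def d (n : ℕ) : S k V ⊗[k] (⋀[k]^(n + 1) V) →ₗ[S k V] S k V ⊗[k] (⋀[k]^n V) :=
  (exteriorPower.alternatingMapLinearEquiv
    (AlternatingMap.alternatizeUncurryFin (dGen (k := k) (V := V) n))).liftBaseChange (S k V)

theorem d_tmul (n : ℕ) (f : S k V) (v : Fin (n + 1) → V) :
    d k V n (f ⊗ₜ exteriorPower.ιMulti k (n + 1) v) =
      ∑ i : Fin (n + 1), (-1 : ℤ) ^ (i : ℕ) •
        ((f * SymmetricAlgebra.ι k V (v i)) ⊗ₜ[k] exteriorPower.ιMulti k n (i.removeNth v)) := by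
  simp only [d, LinearMap.liftBaseChange_tmul,
    exteriorPower.alternatingMapLinearEquiv_apply_ιMulti,
    AlternatingMap.alternatizeUncurryFin_apply, Finset.smul_sum]
  refine Finset.sum_congr rfl fun i _ => ?_
  rw [smul_comm]
  simp [dGen, TensorProduct.smul_tmul']

/-- `δ₂ : ⋀² V ⊗ S → V ⊗ S`, `a ∧ b ⊗ f ↦ b ⊗ a f - a ⊗ b f` (see `d2_tmul`). -/
def d2 : S k V ⊗[k] (⋀[k]^2 V) →ₗ[S k V] S k V ⊗[k] V :=
  ((exteriorPower.oneEquiv k V).toLinearMap.baseChange (S k V)) ∘ₗ d k V 1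

/-- `δ₃ : ⋀³ V ⊗ S → ⋀² V ⊗ S`,
`a ∧ b ∧ c ⊗ f ↦ b ∧ c ⊗ a f - a ∧ c ⊗ b f + a ∧ b ⊗ c f` (see `d3_tmul`). -/
def d3 : S k V ⊗[k] (⋀[k]^3 V) →ₗ[S k V] S k V ⊗[k] (⋀[k]^2 V) := d k V 2

theorem d1_tmul (f : S k V) (v : V) : d1 k V (f ⊗ₜ v) = f * SymmetricAlgebra.ι k V v := by
  simp [d1]

theorem d2_tmul (f : S k V) (a b : V) :
    d2 k V (f ⊗ₜ exteriorPower.ιMulti k 2 ![a, b]) =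
      (f * SymmetricAlgebra.ι k V a) ⊗ₜ[k] b - (f * SymmetricAlgebra.ι k V b) ⊗ₜ[k] a := by
  rw [d2, LinearMap.comp_apply, d_tmul]
  simp [Fin.sum_univ_two, Fin.removeNth, exteriorPower.oneEquiv_ιMulti, sub_eq_add_neg]

theorem d3_tmul (f : S k V) (a b c : V) :
    d3 k V (f ⊗ₜ exteriorPower.ιMulti k 3 ![a, b, c]) =
      (f * SymmetricAlgebra.ι k V a) ⊗ₜ[k] exteriorPower.ιMulti k 2 ![b, c]
      - (f * SymmetricAlgebra.ι k V b) ⊗ₜ[k] exteriorPower.ιMulti k 2 ![a, c]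
      + (f * SymmetricAlgebra.ι k V c) ⊗ₜ[k] exteriorPower.ιMulti k 2 ![a, b] := by
  rw [d3, d_tmul]
  refine (Fin.sum_univ_three _).trans ?_
  have e0 : (0 : Fin 3).removeNth ![a, b, c] = ![b, c] := by
    ext i; fin_cases i <;> rfl
  have e1 : (1 : Fin 3).removeNth ![a, b, c] = ![a, c] := by
    ext i; fin_cases i <;> rfl
  have e2 : (2 : Fin 3).removeNth ![a, b, c] = ![a, b] := by
    ext i; fin_cases i <;> rfl
  rw [e0, e1, e2]
  simp [sub_eq_add_neg]

theorem tmul_induction {n : ℕ} {p : S k V ⊗[k] (⋀[k]^n V) → Prop} (h0 : p 0)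
    (hadd : ∀ x y, p x → p y → p (x + y))
    (hp : ∀ f v, p (f ⊗ₜ exteriorPower.ιMulti k n v)) (x) : p x := by
  induction x with
  | zero => exact h0
  | add a b ha hb => exact hadd _ _ ha hb
  | tmul f w =>
    have hw : w ∈ Submodule.span k (Set.range (exteriorPower.ιMulti k n (M := V))) := by
      rw [exteriorPower.ιMulti_span]; trivial
    induction hw using Submodule.span_induction generalizing f with
    | mem x hx => obtain ⟨v, rfl⟩ := hx; exact hp f v
    | zero => simpa using h0
    | add a b _ _ ha hb => rw [TensorProduct.tmul_add]; exact hadd _ _ (ha f) (hb f)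
    | smul c a _ ha => rw [← TensorProduct.smul_tmul]; exact ha _

theorem d1_d2 (x) : d1 k V (d2 k V x) = 0 := by
  induction x using tmul_induction with
  | h0 => simp
  | hadd x y hx hy => simp [hx, hy]
  | hp f v =>
    have : v = ![v 0, v 1] := by ext i; fin_cases i <;> rfl
    rw [this, d2_tmul, map_sub, d1_tmul, d1_tmul]
    ring

theorem d2_d3 (x) : d2 k V (d3 k V x) = 0 := by
  induction x using tmul_induction with
  | h0 => simp
  | hadd x y hx hy => simp [hx, hy]
  | hp f v =>
    have : v = ![v 0, v 1, v 2] := by ext i; fin_cases i <;> rfl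
    rw [this, d3_tmul, map_add, map_sub, d2_tmul, d2_tmul, d2_tmul]
    rw [mul_right_comm f (SymmetricAlgebra.ι k V (v 1)) (SymmetricAlgebra.ι k V (v 0)),
      mul_right_comm f (SymmetricAlgebra.ι k V (v 2)) (SymmetricAlgebra.ι k V (v 0)),
      mul_right_comm f (SymmetricAlgebra.ι k V (v 2)) (SymmetricAlgebra.ι k V (v 1))]
    abel

variable [FiniteDimensional k V]


/-- The `i`-th partial derivative on `Sym V` with respect to a fixed basis of `V`. -/
def pd (i : Fin (Module.finrank k V)) : S k V →ₗ[k] S k V :=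
  let e := SymmetricAlgebra.equivMvPolynomial (Module.finBasis k V)
  e.symm.toLinearMap ∘ₗ (MvPolynomial.pderiv i).toLinearMap ∘ₗ e.toLinearMap

theorem pd_one (i) : pd k V i 1 = 0 := by
  simp [pd]

theorem pd_ι_mul (i) (v : V) (f : S k V) :
    pd k V i (SymmetricAlgebra.ι k V v * f) = (Module.finBasis k V).repr v i • f + SymmetricAlgebra.ι k V v * pd k V i f := by
  have key : ∀ j, pd k V i (SymmetricAlgebra.ι k V (Module.finBasis k V j) * f) =
      (Module.finBasis k V).repr (Module.finBasis k V j) i • f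
        + SymmetricAlgebra.ι k V (Module.finBasis k V j) * pd k V i f := by
    intro j
    simp only [pd, LinearMap.comp_apply, AlgEquiv.toLinearMap_apply, map_mul,
      SymmetricAlgebra.equivMvPolynomial_ι_apply, Derivation.coeFn_coe, Derivation.leibniz, MvPolynomial.pderiv_X, map_add, smul_eq_mul,
      SymmetricAlgebra.equivMvPolynomial_symm_X, Module.Basis.repr_self, AlgEquiv.symm_apply_apply]
    rw [add_comm]
    congr 1
    by_cases h : i = j
    · subst h; simp
    · simp [Ne.symm h, h]
  have : (pd k V i ∘ₗ (LinearMap.mulRight k f) ∘ₗ SymmetricAlgebra.ι k V : V →ₗ[k] S k V) =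
      ((LinearMap.toSpanSingleton k _ f) ∘ₗ (Module.finBasis k V).coord i)
        + (LinearMap.mulRight k (pd k V i f)) ∘ₗ SymmetricAlgebra.ι k V := by
    apply (Module.finBasis k V).ext
    intro j
    simpa using key j
  simpa using LinearMap.congr_fun this v

/-- The Euler operator of `Sym V`, acting on `Sym^q V` as multiplication by `q`. -/
def eul : S k V →ₗ[k] S k V :=
  ∑ i, LinearMap.mulLeft k (SymmetricAlgebra.ι k V (Module.finBasis k V i)) ∘ₗ pd k V i

theorem sum_repr_ι (v : V) :
    ∑ i, (Module.finBasis k V).repr v i • SymmetricAlgebra.ι k V (Module.finBasis k V i) = SymmetricAlgebra.ι k V v := by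
  conv_rhs => rw [← (Module.finBasis k V).sum_repr v, map_sum]
  simp only [map_smul]

theorem eul_one : eul k V 1 = 0 := by simp [eul, pd_one]

theorem eul_ι_mul (v : V) (f : S k V) : eul k V (SymmetricAlgebra.ι k V v * f) = SymmetricAlgebra.ι k V v * f + SymmetricAlgebra.ι k V v * eul k V f := by
  simp only [eul, LinearMap.sum_apply, LinearMap.comp_apply, pd_ι_mul, LinearMap.mulLeft_apply,
    mul_add, Finset.sum_add_distrib, Finset.mul_sum]
  congr 1
  · rw [← sum_repr_ι k V v, Finset.sum_mul]
    exact Finset.sum_congr rfl fun i _ => by simp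
  · exact Finset.sum_congr rfl fun i _ => by ring

theorem eul_mul_ι (v : V) (f : S k V) : eul k V (f * SymmetricAlgebra.ι k V v) = f * SymmetricAlgebra.ι k V v + eul k V f * SymmetricAlgebra.ι k V v := by
  rw [mul_comm, eul_ι_mul, mul_comm, mul_comm (SymmetricAlgebra.ι k V v)]

theorem iSup_eig_eul (f : S k V) :
    f ∈ ⨆ q : ℕ, Module.End.eigenspace (eul k V) (q : k) := by
  set T := ⨆ q : ℕ, Module.End.eigenspace (eul k V) (q : k) with hT
  have hmul : ∀ v, ∀ g ∈ T, SymmetricAlgebra.ι k V v * g ∈ T := by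
    intro v g hg
    have : T ≤ T.comap (LinearMap.mulLeft k (SymmetricAlgebra.ι k V v)) := by
      conv_lhs => rw [hT]
      refine iSup_le fun q x hx => ?_
      rw [Module.End.mem_eigenspace_iff] at hx
      refine Submodule.mem_iSup_of_mem (q + 1) ?_
      rw [Module.End.mem_eigenspace_iff, LinearMap.mulLeft_apply, eul_ι_mul, hx]
      push_cast
      rw [add_smul, one_smul, mul_smul_comm, add_comm]
    exact this hg
  have h1 : (1 : S k V) ∈ T :=
    Submodule.mem_iSup_of_mem 0 (by simp [eul_one])
  have : ∀ g ∈ T, f * g ∈ T := by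
    induction f using SymmetricAlgebra.induction with
    | algebraMap r => intro g hg; rw [← Algebra.smul_def]; exact T.smul_mem r hg
    | ι x => exact hmul x
    | mul a b ha hb => intro g hg; rw [mul_assoc]; exact ha _ (hb _ hg)
    | add a b ha hb => intro g hg; rw [add_mul]; exact T.add_mem (ha _ hg) (hb _ hg)
  simpa using this 1 h1

theorem mem_of_eul [CharZero k] {M : Type*} [AddCommGroup M] [Module k M]
    (N : Submodule k (S k V ⊗[k] M)) (hN : ∀ x ∈ N, (eul k V).rTensor M x ∈ N)
    (p : ℕ) (hp : p ≠ 0) (z : S k V ⊗[k] M)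
    (hz : (eul k V).rTensor M z + (p : k) • z ∈ N) : z ∈ N := by
  let E' : Module.End k ((S k V ⊗[k] M) ⧸ N) := N.mapQ N ((eul k V).rTensor M) hN
  have hE : ∀ x, E' (N.mkQ x) = N.mkQ ((eul k V).rTensor M x) := fun x => rfl
  have h1 : ∀ x, N.mkQ x ∈ ⨆ q : ℕ, Module.End.eigenspace E' (q : k) := by
    intro x
    induction x with
    | zero => simp
    | add a b ha hb => rw [map_add]; exact Submodule.add_mem _ ha hb
    | tmul f m =>
      have : ⨆ q : ℕ, Module.End.eigenspace (eul k V) (q : k) ≤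
          (⨆ q : ℕ, Module.End.eigenspace E' (q : k)).comap
            (N.mkQ ∘ₗ (TensorProduct.mk k (S k V) M).flip m) := by
        refine iSup_le fun q x hx => Submodule.mem_iSup_of_mem q ?_
        rw [Module.End.mem_eigenspace_iff] at hx ⊢
        simp only [LinearMap.comp_apply, hE, LinearMap.flip_apply, TensorProduct.mk_apply,
          LinearMap.rTensor_tmul, hx]
        rw [← TensorProduct.smul_tmul', map_smul]
      exact this (iSup_eig_eul k V f)
  have h2 : N.mkQ z ∈ Module.End.eigenspace E' (-(p : k)) := by
    rw [Module.End.mem_eigenspace_iff, hE, neg_smul, eq_neg_iff_add_eq_zero, ← map_smul, ← map_add]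
    exact (Submodule.Quotient.mk_eq_zero N).mpr hz
  have h3 := (Module.End.eigenspaces_iSupIndep E') (-(p : k))
  have h4 : (⨆ q : ℕ, Module.End.eigenspace E' (q : k)) ≤
      ⨆ j, ⨆ (_ : j ≠ -(p : k)), Module.End.eigenspace E' j := by
    refine iSup_le fun q => le_iSup₂_of_le (q : k) ?_ le_rfl
    intro h
    rw [eq_neg_iff_add_eq_zero] at h
    norm_cast at h
    omega
  have h5 := (Submodule.disjoint_def.mp h3) _ h2 (h4 (h1 z))
  simpa using h5

/-- The contracting homotopy `f ⊗ v ↦ ∑ᵢ ∂ᵢ f ⊗ (bᵢ ∧ v)`. -/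
def h1 : S k V ⊗[k] V →ₗ[k] S k V ⊗[k] (⋀[k]^2 V) :=
  TensorProduct.lift (∑ i, ((TensorProduct.mk k (S k V) (⋀[k]^2 V)).compl₂
    (exteriorPower.alternatingMapLinearEquiv
      ((exteriorPower.ιMulti k 2).curryLeft (Module.finBasis k V i)) ∘ₗ
        (exteriorPower.oneEquiv k V).symm.toLinearMap)) ∘ₗ pd k V i)

theorem h1_tmul (f : S k V) (v : V) : h1 k V (f ⊗ₜ v) =
    ∑ i, pd k V i f ⊗ₜ[k] exteriorPower.ιMulti k 2 ![Module.finBasis k V i, v] := by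
  have : (exteriorPower.oneEquiv k V).symm v = exteriorPower.ιMulti k 1 ![v] := by
    rw [LinearEquiv.symm_apply_eq]; simp [exteriorPower.oneEquiv_ιMulti]
  simp [h1, this, LinearMap.sum_apply]


/-- The contracting homotopy `f ↦ ∑ᵢ ∂ᵢ f ⊗ bᵢ`. -/
def h0 : S k V →ₗ[k] S k V ⊗[k] V :=
  ∑ i, (TensorProduct.mk k (S k V) V).flip (Module.finBasis k V i) ∘ₗ pd k V i

theorem d2_h1 (x) : d2 k V (h1 k V x) + h0 k V (d1 k V x) =
    (eul k V).rTensor V x + x := by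
  induction x with
  | zero => simp
  | add a b ha hb =>
    simp only [map_add]
    rw [add_add_add_comm, ha, hb]; abel
  | tmul f v =>
    simp only [h1_tmul, d1_tmul, map_sum, d2_tmul, LinearMap.rTensor_tmul, eul, LinearMap.sum_apply,
      LinearMap.comp_apply, LinearMap.mulLeft_apply, TensorProduct.sum_tmul, h0,
      mul_comm f, pd_ι_mul, LinearMap.flip_apply, TensorProduct.mk_apply, TensorProduct.add_tmul,
      Finset.sum_add_distrib, Finset.sum_sub_distrib]
    have : ∑ i, ((Module.finBasis k V).repr v i • f) ⊗ₜ[k] (Module.finBasis k V i) = f ⊗ₜ v := by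
      conv_rhs => rw [← (Module.finBasis k V).sum_repr v, TensorProduct.tmul_sum]
      simp [TensorProduct.smul_tmul]
    rw [this]
    simp only [mul_comm]
    abel

theorem eul_d2 (x) : (eul k V).rTensor V (d2 k V x) =
    d2 k V ((eul k V).rTensor _ x + x) := by
  induction x using tmul_induction with
  | h0 => simp
  | hadd x y hx hy => simp only [map_add] at *; rw [hx, hy]; abel
  | hp f v =>
    have : v = ![v 0, v 1] := by ext i; fin_cases i <;> rfl
    rw [this, d2_tmul, map_add, LinearMap.rTensor_tmul, d2_tmul, d2_tmul, map_sub]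
    simp only [LinearMap.rTensor_tmul, eul_mul_ι, TensorProduct.add_tmul]
    abel

theorem eul_d3 (x) : (eul k V).rTensor _ (d3 k V x) =
    d3 k V ((eul k V).rTensor _ x + x) := by
  induction x using tmul_induction with
  | h0 => simp
  | hadd x y hx hy => simp only [map_add] at *; rw [hx, hy]; abel
  | hp f v =>
    have : v = ![v 0, v 1, v 2] := by ext i; fin_cases i <;> rfl
    rw [this, d3_tmul, map_add (d3 k V), LinearMap.rTensor_tmul, d3_tmul, d3_tmul, map_add, map_sub]
    simp only [LinearMap.rTensor_tmul, eul_mul_ι, TensorProduct.add_tmul]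
    abel

theorem h1_d2 (x) : ∃ y, h1 k V (d2 k V x) + d3 k V y = (eul k V).rTensor _ x + (2 : k) • x := by
  induction x using tmul_induction with
  | h0 => exact ⟨0, by simp⟩
  | hadd x y hx hy =>
    obtain ⟨a, ha⟩ := hx
    obtain ⟨b, hb⟩ := hy
    refine ⟨a + b, ?_⟩
    simp only [map_add, smul_add]
    rw [add_add_add_comm, ha, hb]; abel
  | hp f v =>
    have : v = ![v 0, v 1] := by ext i; fin_cases i <;> rfl
    rw [this]
    generalize v 0 = a
    generalize v 1 = b
    refine ⟨∑ i, pd k V i f ⊗ₜ exteriorPower.ιMulti k 3 ![Module.finBasis k V i, a, b], ?_⟩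
    have hs : ∀ u w : V, ∑ i, ((Module.finBasis k V).repr u i • f) ⊗ₜ[k]
        (exteriorPower.ιMulti k 2 ![Module.finBasis k V i, w]) =
          f ⊗ₜ exteriorPower.ιMulti k 2 ![u, w] := by
      intro u w
      have h : ∀ u : V, exteriorPower.ιMulti k 2 ![u, w] =
          ((exteriorPower.ιMulti k 2).toMultilinearMap.toLinearMap ![0, w] 0) u := by
        intro u
        change _ = exteriorPower.ιMulti k 2 (Function.update ![0, w] 0 u)
        congr 1; ext i; fin_cases i <;> simp
      conv_rhs => rw [h, ← (Module.finBasis k V).sum_repr u, map_sum, TensorProduct.tmul_sum]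
      refine Finset.sum_congr rfl fun i _ => ?_
      rw [map_smul, ← h, TensorProduct.smul_tmul]
    have hswap : exteriorPower.ιMulti k 2 ![b, a] = - exteriorPower.ιMulti k 2 ![a, b] := by
      have := (exteriorPower.ιMulti k 2 (M := V)).map_swap ![a, b] (i := 0) (j := 1) (by decide)
      rw [← this]; congr 1; ext i; fin_cases i <;> rfl
    simp only [d2_tmul, map_sub, h1_tmul, map_sum, d3_tmul, mul_comm f, pd_ι_mul,
      TensorProduct.add_tmul, Finset.sum_add_distrib, Finset.sum_sub_distrib, hs,
      LinearMap.rTensor_tmul, eul, LinearMap.sum_apply, LinearMap.comp_apply,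
      LinearMap.mulLeft_apply, TensorProduct.sum_tmul, hswap, TensorProduct.tmul_neg, two_smul]
    simp only [mul_comm]
    abel

theorem exact₁ [CharZero k] (z : S k V ⊗[k] V) (hz : d1 k V z = 0) :
    z ∈ LinearMap.range (d2 k V) := by
  refine mem_of_eul k V ((LinearMap.range (d2 k V)).restrictScalars k) ?_ 1 one_ne_zero z ?_
  · rintro _ ⟨x, rfl⟩
    exact ⟨_, (eul_d2 k V x).symm⟩
  · have := d2_h1 k V z
    rw [hz, map_zero, add_zero] at this
    refine ⟨h1 k V z, ?_⟩
    rw [this]; simp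

theorem exact₂ [CharZero k] (z : S k V ⊗[k] (⋀[k]^2 V)) (hz : d2 k V z = 0) :
    z ∈ LinearMap.range (d3 k V) := by
  refine mem_of_eul k V ((LinearMap.range (d3 k V)).restrictScalars k) ?_ 2 two_ne_zero z ?_
  · rintro _ ⟨x, rfl⟩
    exact ⟨_, (eul_d3 k V x).symm⟩
  · obtain ⟨y, hy⟩ := h1_d2 k V z
    rw [hz, map_zero, zero_add] at hy
    exact ⟨y, by rw [hy]; simp⟩

end KoszulComplex

/-! ### Koszul modules -/

section KoszulModules

variable {k : Type*} [Field k] {V : Type*} [AddCommGroup V] [Module k V]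

/-- The boundaries `δ₂(K ⊗ S) ⊆ V ⊗ S`. -/
def boundaries (K : Submodule k (⋀[k]^2 V)) : Submodule (S k V) (S k V ⊗[k] V) :=
  LinearMap.range (d2 k V ∘ₗ K.subtype.baseChange (S k V))

/-- The Koszul module `W(V,K)`: the middle homology `ker δ₁ / δ₂(K ⊗ S)` of `K ⊗ S → V ⊗ S → S`,
realized as the submodule of `(V ⊗ S) / δ₂(K ⊗ S)` formed by the classes of elements of `ker δ₁`. -/
abbrev W (K : Submodule k (⋀[k]^2 V)) : Submodule (S k V) ((S k V ⊗[k] V) ⧸ boundaries K) :=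
  (LinearMap.ker (d1 k V)).map (boundaries K).mkQ

/-- The degree `q` piece `W_q(V,K)`: classes of elements of `ker δ₁` lying in `V ⊗ Sym^{q+1} V`. -/
def Wdeg (K : Submodule k (⋀[k]^2 V)) (q : ℕ) : Submodule k (W K) :=
  (((LinearMap.ker (d1 k V)).restrictScalars k ⊓ symPart k V V (q + 1)).map
    ((boundaries K).mkQ.restrictScalars k)).comap ((W K).subtype.restrictScalars k)

/-- The map `(⋀³ V ⊕ K) ⊗ S → ⋀² V ⊗ S` given by `δ₃` and the inclusion of `K`. -/
def presMap (K : Submodule k (⋀[k]^2 V)) :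
    (S k V ⊗[k] (⋀[k]^3 V)) × (S k V ⊗[k] K) →ₗ[S k V] S k V ⊗[k] (⋀[k]^2 V) :=
  (d3 k V).coprod (K.subtype.baseChange (S k V))

variable {V' : Type*} [AddCommGroup V'] [Module k V']

/-- For `φ : V → V'`, the `S`-module `W̃(V', K')` with `K' = (⋀² φ)(K)`: the cokernel of
`(⋀³ V ⊕ K) ⊗ S → ⋀² V ⊗ S → ⋀² V' ⊗ S`, where `S = Sym V`. -/
abbrev Wtilde (φ : V →ₗ[k] V') (K : Submodule k (⋀[k]^2 V)) : Type _ :=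
  (S k V ⊗[k] (⋀[k]^2 V')) ⧸
    LinearMap.range ((exteriorPower.map 2 φ).baseChange (S k V) ∘ₗ presMap K)

/-- The degree `q` piece of `W̃(V', K')`: classes of elements of `⋀² V' ⊗ Sym^q V`. -/
def WtildeDeg (φ : V →ₗ[k] V') (K : Submodule k (⋀[k]^2 V)) (q : ℕ) :
    Submodule k (Wtilde φ K) :=
  (symPart k V (⋀[k]^2 V') q).map ((Submodule.mkQ _).restrictScalars k)

/-- The map `⋀² V ⊗ S → W(V,K)` sending `x` to the class of `δ₂ x`. -/
def ofWedge (K : Submodule k (⋀[k]^2 V)) : S k V ⊗[k] (⋀[k]^2 V) →ₗ[S k V] W K :=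
  ((boundaries K).mkQ ∘ₗ d2 k V).codRestrict (W K)
    fun x => ⟨d2 k V x, d1_d2 k V x, rfl⟩

variable [CharZero k] [FiniteDimensional k V]

theorem ofWedge_surjective (K : Submodule k (⋀[k]^2 V)) : Function.Surjective (ofWedge K) := by
  rintro ⟨_, z, hz, rfl⟩
  obtain ⟨x, hx⟩ := exact₁ k V z hz
  exact ⟨x, Subtype.ext (congrArg (boundaries K).mkQ hx)⟩

theorem ker_ofWedge (K : Submodule k (⋀[k]^2 V)) :
    LinearMap.ker (ofWedge K) = LinearMap.range (presMap K) := by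
  ext x
  have h : ofWedge K x = 0 ↔ ∃ y, d2 k V (K.subtype.baseChange (S k V) y) = d2 k V x := by
    rw [← Submodule.coe_eq_zero]
    exact Submodule.Quotient.mk_eq_zero (boundaries K)
  rw [LinearMap.mem_ker, h]
  constructor
  · rintro ⟨y, hy⟩
    obtain ⟨w, hw⟩ := exact₂ k V (x - K.subtype.baseChange (S k V) y) (by rw [map_sub, hy, sub_self])
    exact ⟨(w, y), by rw [presMap, LinearMap.coprod_apply, hw]; simp⟩
  · rintro ⟨⟨w, y⟩, rfl⟩
    exact ⟨y, by rw [presMap, LinearMap.coprod_apply, map_add, d2_d3, zero_add]⟩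

/-- The identification of `W(V,K)` with the cokernel of `(⋀³ V ⊕ K) ⊗ S → ⋀² V ⊗ S`, induced by
`δ₂`. -/
def presEquiv (K : Submodule k (⋀[k]^2 V)) :
    ((S k V ⊗[k] (⋀[k]^2 V)) ⧸ LinearMap.range (presMap K)) ≃ₗ[S k V] W K :=
  (Submodule.quotEquivOfEq _ _ (ker_ofWedge K).symm).trans
    ((ofWedge K).quotKerEquivOfSurjective (ofWedge_surjective K))

/-- The natural map `W(V,K) → W̃(V', K')` induced by `φ : V → V'`: under the identification of
`W(V,K)` with a cokernel it is induced by `⋀² φ ⊗ id : ⋀² V ⊗ S → ⋀² V' ⊗ S`. -/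
def toWtilde (φ : V →ₗ[k] V') (K : Submodule k (⋀[k]^2 V)) : W K →ₗ[S k V] Wtilde φ K :=
  Submodule.mapQ _ _ ((exteriorPower.map 2 φ).baseChange (S k V))
    (by rw [LinearMap.range_comp]; exact Submodule.le_comap_map _ _) ∘ₗ
    (presEquiv K).symm.toLinearMap

theorem toWtilde_ofWedge (φ : V →ₗ[k] V') (K : Submodule k (⋀[k]^2 V))
    (x : S k V ⊗[k] (⋀[k]^2 V)) :
    toWtilde φ K (ofWedge K x) =
      Submodule.Quotient.mk ((exteriorPower.map 2 φ).baseChange (S k V) x) := by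
  have : (presEquiv K).symm (ofWedge K x) = Submodule.Quotient.mk x := by
    rw [LinearEquiv.symm_apply_eq]; rfl
  rw [toWtilde, LinearMap.comp_apply, LinearEquiv.coe_coe, this]
  rfl

end KoszulModules

/-! ### Resonance -/

section Resonance

variable {k : Type*} [Field k] {V : Type*} [AddCommGroup V] [Module k V]

/-- `K^⊥ ⊆ ⋀² V^∨`: the elements vanishing on `K` under the pairing
`⟨a ∧ b, v ∧ w⟩ = a(v) b(w) - a(w) b(v)`. -/
def perp (K : Submodule k (⋀[k]^2 V)) : Submodule k (⋀[k]^2 (Module.Dual k V)) :=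
  K.dualAnnihilator.comap (exteriorPower.pairingDual k V 2)

/-- The resonance variety `R(V,K) ⊆ V^∨`, as a set. -/
def resonance (K : Submodule k (⋀[k]^2 V)) : Set (Module.Dual k V) :=
  {a | ∃ b, exteriorPower.ιMulti k 2 ![a, b] ∈ perp K ∧ exteriorPower.ιMulti k 2 ![a, b] ≠ 0} ∪ {0}

variable (k V) in
/-- The Zariski topology on the affine space `V^∨`, with the basic open sets `{a | f(a) ≠ 0}` for
`f ∈ Sym V`, the algebra of polynomial functions on `V^∨`. -/
abbrev zariski : TopologicalSpace (Module.Dual k V) :=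
  TopologicalSpace.generateFrom
    {O | ∃ f : SymmetricAlgebra k V, O = {a | SymmetricAlgebra.lift a f ≠ 0}}

/-- The irreducible components of a subset of `V^∨`: its maximal irreducible subsets in the Zariski
topology. -/
def components (R : Set (Module.Dual k V)) : Set (Set (Module.Dual k V)) :=
  {Z | Maximal (fun Y => Y ⊆ R ∧ @IsIrreducible _ (zariski k V) Y) Z}

/-- The subspace `⋀² U ⊆ ⋀² V^∨` for a subspace `U ⊆ V^∨`. -/
def wedgeSq (U : Submodule k (Module.Dual k V)) : Submodule k (⋀[k]^2 (Module.Dual k V)) :=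
  Submodule.span k {ω | ∃ a ∈ U, ∃ b ∈ U, ω = exteriorPower.ιMulti k 2 ![a, b]}

/-- A subspace `U ⊆ V^∨` is separable with respect to `K` if `K^⊥ ∩ ⟨U⟩_E ⊆ ⋀² U`, where `⟨U⟩_E` is
the ideal generated by `U` in the exterior algebra `E` of `V^∨`. -/
def IsSeparableSubspace (K : Submodule k (⋀[k]^2 V)) (U : Submodule k (Module.Dual k V)) : Prop :=
  ∀ η ∈ perp K,
    (η : ExteriorAlgebra k (Module.Dual k V)) ∈
        TwoSidedIdeal.span (ExteriorAlgebra.ι k '' (U : Set (Module.Dual k V))) →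
      η ∈ wedgeSq U

/-- `W(V,K)` is separable if every irreducible component of the resonance variety is a linear
subspace of `V^∨` and is separable with respect to `K`. -/
def IsSeparable (K : Submodule k (⋀[k]^2 V)) : Prop :=
  ∀ Z ∈ components (resonance K),
    ∃ U : Submodule k (Module.Dual k V), (U : Set (Module.Dual k V)) = Z ∧ IsSeparableSubspace K U

/-- For a subspace `U ⊆ V^∨`, the quotient `V̄` of `V` with `V̄^∨ = U`, i.e. the quotient of `V` by
`{v | u(v) = 0 for all u ∈ U}`. -/
abbrev Vbar (U : Submodule k (Module.Dual k V)) : Type _ := V ⧸ U.dualCoannihilator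

/-- The projection `π : V → V̄`, dual to the inclusion `U ⊆ V^∨`. -/
def proj (U : Submodule k (Module.Dual k V)) : V →ₗ[k] Vbar U := U.dualCoannihilator.mkQ

/-- `K̄ = (⋀² π)(K) ⊆ ⋀² V̄`. -/
def Kbar (K : Submodule k (⋀[k]^2 V)) (U : Submodule k (Module.Dual k V)) :
    Submodule k (⋀[k]^2 (Vbar U)) :=
  K.map (exteriorPower.map 2 (proj U))

/-- The natural map `Π = (π₁, …, πₙ) : W(V,K) → ⨁ₜ W̃(V̄ₜ, K̄ₜ)` attached to finitely many subspaces
`V̄ₜ^∨ = U t` of `V^∨`. -/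
def PiMap [CharZero k] [FiniteDimensional k V] (K : Submodule k (⋀[k]^2 V)) {n : ℕ}
    (U : Fin n → Submodule k (Module.Dual k V)) :
    W K →ₗ[S k V] ((t : Fin n) → Wtilde (proj (U t)) K) :=
  LinearMap.pi fun t => toWtilde (proj (U t)) K

end Resonance

end Koszul

end

namespace Koszul

/-! ### Finiteness of the set of irreducible components -/

section Topology

variable {k : Type*} [Field k] {V : Type*} [AddCommGroup V] [Module k V]

/-! Write `L_t ⊆ V` for the annihilator of the component `U_t`, `I_L` for the ideal of `Sym V`
generated by `L`, and `P_L ⊆ W(V,K)` for the submodule generated by the classes of `L ∧ V`.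
Separability of `U_t` dualizes to `L_t ∧ V ⊆ K + ⋀² L_t` (`IsSeparableSubspace.wedgeSpan_le`). A
nonzero `a` outside the resonance variety satisfies the same inclusion with `L = ker a`
(`wedgeSpan_ker_top_le`), and there `P_L` is all of `W(V,K)`.

Whenever `L ∧ V ⊆ K + ⋀² L`, the Koszul relation `e (u ∧ v) = v (u ∧ e) - u (v ∧ e)` gives `e P_L ⊆
I_L P_L` for every `e ∈ V`. By Cayley–Hamilton a monic polynomial in `e`, with lower coefficients in
`I_L`, kills `P_L`. At a point `a` of the annihilator of `L` with `a(e) = 1` this polynomial takes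
the value `1`, so `P_L` vanishes locally at every nonzero such point
(`exists_smul_classSpan_eq_zero`).

Injectivity: the kernel of `Π` lies in every `P_{L_t}`, and the components cover the resonance
variety, so the annihilator of the kernel has no common zero other than possibly the origin. The
Nullstellensatz makes a power of the irrelevant ideal kill the kernel, and Artin–Rees shows that the
kernel meets `W_q` trivially for large `q` (`exists_Wdeg_disjoint`).

Surjectivity: local vanishing also forces distinct components to meet only in `0`
(`IsSeparableSubspace.inf_eq_bot`), so `L_t + L_{t'} = V`. In degrees `q ≥ n` every polynomial is
then a sum of one in `I_{L_t}` and one in `I_{L_{t'}}` for all `t' ≠ t`. Since `I_{L_t}` kills the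
`t`-th summand of the target, each summand is reached separately (`surjOn_PiMap`).

For the dimension formula, the same vanishing lets one replace `Sym V` by `Sym V̄_t` in `W̃(V̄_t,
K̄_t)` without changing the graded pieces (`finrank_WtildeDeg`). -/

instance isNoetherianRing_S [FiniteDimensional k V] : IsNoetherianRing (S k V) :=
  isNoetherianRing_of_ringEquiv _
    (SymmetricAlgebra.equivMvPolynomial (Module.finBasis k V)).symm.toRingEquiv

/-- The point of `Spec (Sym V)` attached to a linear form on `V`. -/
def toSpec (a : Module.Dual k V) : PrimeSpectrum (S k V) :=
  ⟨RingHom.ker (SymmetricAlgebra.lift a).toRingHom, RingHom.ker_isPrime _⟩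

/-- Basic open sets are the preimages of those of the spectrum, so noetherianity passes from `Spec
(Sym V)` to `V^∨`. -/
theorem zariski_eq_induced :
    zariski k V = TopologicalSpace.induced toSpec inferInstance := by
  refine Eq.trans ?_ (congrArg (TopologicalSpace.induced toSpec)
    PrimeSpectrum.isTopologicalBasis_basic_opens.eq_generateFrom).symm
  rw [induced_generateFrom_eq]
  refine congrArg TopologicalSpace.generateFrom (Set.ext fun O => ?_)
  constructor
  · rintro ⟨f, rfl⟩
    exact ⟨_, ⟨f, rfl⟩, rfl⟩
  · rintro ⟨_, ⟨f, rfl⟩, rfl⟩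
    exact ⟨f, rfl⟩

theorem noetherianSpace_zariski [FiniteDimensional k V] :
    @TopologicalSpace.NoetherianSpace _ (zariski k V) := by
  let := zariski k V
  exact (Topology.IsInducing.mk zariski_eq_induced :
    Topology.IsInducing (toSpec (k := k) (V := V))).noetherianSpace

/-- Irreducibility of a subset of `R` does not depend on whether it is tested in `R` or in `V^∨`.
This makes the general theory of components of a noetherian space available. -/
theorem components_eq (R : Set (Module.Dual k V)) :
    components R = (fun Z : Set R => Subtype.val '' Z) ''
      @irreducibleComponents R (@instTopologicalSpaceSubtype _ _ (zariski k V)) := by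
  let := zariski k V
  have hpre : ∀ Y : Set (Module.Dual k V), Y ⊆ R → IsIrreducible Y →
      IsIrreducible (Subtype.val ⁻¹' Y : Set R) := by
    rintro Y hY ⟨⟨y, hy⟩, h⟩
    refine ⟨⟨⟨y, hY hy⟩, hy⟩, ?_⟩
    rintro _ _ ⟨u, hu, rfl⟩ ⟨v, hv, rfl⟩ ⟨a, ha, hau⟩ ⟨b, hb, hbv⟩
    obtain ⟨c, hc, hcuv⟩ := h u v hu hv ⟨a, ha, hau⟩ ⟨b, hb, hbv⟩
    exact ⟨⟨c, hY hc⟩, hc, hcuv⟩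
  have himg : ∀ Z : Set R, IsIrreducible Z → IsIrreducible (Subtype.val '' Z) :=
    fun Z hZ => hZ.image _ continuous_subtype_val.continuousOn
  ext Y
  constructor
  · rintro ⟨⟨hY, hYi⟩, hmax⟩
    have hcoe : Subtype.val '' (Subtype.val ⁻¹' Y : Set R) = Y := by
      rw [Subtype.image_preimage_coe, Set.inter_eq_right.mpr hY]
    refine ⟨Subtype.val ⁻¹' Y, ⟨hpre Y hY hYi, fun Z hZ hle => ?_⟩, hcoe⟩
    have := hmax (y := Subtype.val '' Z) ⟨by simp, himg Z hZ⟩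
      (by rw [← hcoe]; exact Set.image_mono hle)
    exact Set.image_subset_iff.mp this
  · rintro ⟨Z, ⟨hZ, hmax⟩, rfl⟩
    refine ⟨⟨by simp, himg Z hZ⟩, fun Y ⟨hY, hYi⟩ hle => ?_⟩
    have := hmax (hpre Y hY hYi) (Set.image_subset_iff.mp hle)
    intro y hy
    exact ⟨⟨y, hY hy⟩, this hy, rfl⟩

theorem finite_components [FiniteDimensional k V] (R : Set (Module.Dual k V)) :
    (components R).Finite := by
  rw [components_eq]
  let := zariski k V
  have := noetherianSpace_zariski (k := k) (V := V)
  have : TopologicalSpace.NoetherianSpace R :=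
    Topology.IsInducing.subtypeVal.noetherianSpace
  exact TopologicalSpace.NoetherianSpace.finite_irreducibleComponents.image _

theorem exists_mem_components (R : Set (Module.Dual k V)) {a : Module.Dual k V} (ha : a ∈ R) :
    ∃ Z ∈ components R, a ∈ Z := by
  rw [components_eq]
  let := zariski k V
  exact ⟨_, ⟨_, irreducibleComponent_mem_irreducibleComponents (⟨a, ha⟩ : R), rfl⟩,
    ⟨a, ha⟩, mem_irreducibleComponent, rfl⟩

end Topology

/-! ### Ideals of linear forms and the Nullstellensatz -/

section Nullstellensatz

variable (k : Type*) [Field k] (V : Type*) [AddCommGroup V] [Module k V]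

/-- The ideal of `Sym V` generated by a subspace of `V`. -/
def linIdeal (L : Submodule k V) : Ideal (S k V) :=
  Ideal.span (SymmetricAlgebra.ι k V '' L)

variable {k V}

theorem ι_mem_linIdeal {L : Submodule k V} {v : V} (hv : v ∈ L) :
    SymmetricAlgebra.ι k V v ∈ linIdeal k V L :=
  Ideal.subset_span ⟨v, hv, rfl⟩

theorem linIdeal_le {L : Submodule k V} {J : Ideal (S k V)}
    (h : ∀ v ∈ L, SymmetricAlgebra.ι k V v ∈ J) : linIdeal k V L ≤ J :=
  Ideal.span_le.mpr (by rintro _ ⟨v, hv, rfl⟩; exact h v hv)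

theorem lift_eq_zero_of_mem_linIdeal {L : Submodule k V} {a : Module.Dual k V}
    (ha : ∀ v ∈ L, a v = 0) {f : S k V} (hf : f ∈ linIdeal k V L) :
    SymmetricAlgebra.lift a f = 0 := by
  have : linIdeal k V L ≤ RingHom.ker (SymmetricAlgebra.lift a).toRingHom :=
    linIdeal_le fun v hv => by simp [RingHom.mem_ker, ha v hv]
  exact this hf

/-- The zero locus of `J` is contained in the origin, so every linear form lies in the radical of
`J`; the irrelevant ideal is finitely generated, so one power suffices. -/
theorem exists_pow_linIdeal_top_le [IsAlgClosed k] [FiniteDimensional k V] (J : Ideal (S k V))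
    (hJ : ∀ a : Module.Dual k V, a ≠ 0 → ∃ s ∈ J, SymmetricAlgebra.lift a s ≠ 0) :
    ∃ N : ℕ, linIdeal k V ⊤ ^ N ≤ J := by
  refine Ideal.exists_pow_le_of_le_radical_of_fg (linIdeal_le fun v _ => ?_)
    (IsNoetherian.noetherian _)
  set b := Module.finBasis k V
  set e := SymmetricAlgebra.equivMvPolynomial b
  have key : e (SymmetricAlgebra.ι k V v) ∈ (J.map (e : S k V →+* _)).radical := by
    rw [← MvPolynomial.vanishingIdeal_zeroLocus_eq_radical (K := k), MvPolynomial.mem_vanishingIdeal_iff]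
    intro x hx
    set a : Module.Dual k V := b.constr k x
    have hev : ∀ f, MvPolynomial.aeval x (e f) = SymmetricAlgebra.lift a f := by
      intro f
      have : (MvPolynomial.aeval x).comp e.toAlgHom = SymmetricAlgebra.lift a := by
        refine SymmetricAlgebra.algHom_ext (b.ext fun i => ?_)
        simp [a, e]
      exact DFunLike.congr_fun this f
    -- At the origin the linear form `v` itself vanishes; any other point is excluded from the zero
    -- locus by `hJ`.
    by_cases ha : a = 0
    · rw [hev, ha]; simp
    · obtain ⟨s, hs, hsa⟩ := hJ a ha
      exact absurd ((hev s).symm.trans (hx _ (Ideal.mem_map_of_mem _ hs))) hsa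
  obtain ⟨n, hn⟩ := key
  refine ⟨n, ?_⟩
  have hn' : e (SymmetricAlgebra.ι k V v ^ n) ∈ J.map (e : S k V →+* _) := by
    rwa [map_pow]
  obtain ⟨y, hy, hye⟩ := (Ideal.mem_map_iff_of_surjective _ e.surjective).mp hn'
  rwa [← e.injective hye]

end Nullstellensatz

/-! ### Bilinear calculus in the second exterior power -/

section Wedge

variable (k : Type*) [Field k] (V : Type*) [AddCommGroup V] [Module k V]

theorem update_zero_vec {V : Type*} (a b c : V) : Function.update ![a, b] 0 c = ![c, b] := by
  ext i; fin_cases i <;> rfl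

theorem update_one_vec {V : Type*} (a b c : V) : Function.update ![a, b] 1 c = ![a, c] := by
  ext i; fin_cases i <;> rfl

/-- The bilinear map `(v, w) ↦ v ∧ w`. -/
def wedge : V →ₗ[k] V →ₗ[k] ⋀[k]^2 V :=
  LinearMap.mk₂ k (fun v w => exteriorPower.ιMulti k 2 ![v, w])
    (fun a b c => by
      have := (exteriorPower.ιMulti k 2).map_update_add ![a, c] 0 a b
      rwa [update_zero_vec, update_zero_vec, update_zero_vec] at this)
    (fun r a c => by
      have := (exteriorPower.ιMulti k 2).map_update_smul ![a, c] 0 r a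
      rwa [update_zero_vec, update_zero_vec] at this)
    (fun a b c => by
      have := (exteriorPower.ιMulti k 2).map_update_add ![a, b] 1 b c
      rwa [update_one_vec, update_one_vec, update_one_vec] at this)
    (fun r a c => by
      have := (exteriorPower.ιMulti k 2).map_update_smul ![a, c] 1 r c
      rwa [update_one_vec, update_one_vec] at this)

variable {k V}

theorem ιMulti_two (v w : V) : exteriorPower.ιMulti k 2 ![v, w] = wedge k V v w := rfl

theorem wedge_self (v : V) : wedge k V v v = 0 :=
  (exteriorPower.ιMulti k 2).map_eq_zero_of_eq ![v, v] (i := 0) (j := 1) rfl (by decide)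

theorem wedge_swap (v w : V) : wedge k V v w = -wedge k V w v := by
  have := wedge_self (k := k) (v + w)
  simp only [map_add, LinearMap.add_apply, wedge_self, zero_add, add_zero] at this
  rw [add_comm] at this
  exact eq_neg_of_add_eq_zero_left (by rwa [add_comm] at this ⊢)

theorem span_wedge_eq_top :
    Submodule.span k {x | ∃ v w : V, x = wedge k V v w} = ⊤ := by
  rw [eq_top_iff, ← exteriorPower.ιMulti_span]
  refine Submodule.span_mono ?_
  rintro _ ⟨v, rfl⟩
  exact ⟨v 0, v 1, by rw [← ιMulti_two]; congr 1; ext i; fin_cases i <;> rfl⟩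

theorem wedge_hom_ext {M : Type*} [AddCommGroup M] [Module k M] {f g : ⋀[k]^2 V →ₗ[k] M}
    (h : ∀ v w, f (wedge k V v w) = g (wedge k V v w)) : f = g :=
  LinearMap.ext_on span_wedge_eq_top (by rintro _ ⟨v, w, rfl⟩; exact h v w)

theorem map_wedge {V' : Type*} [AddCommGroup V'] [Module k V'] (φ : V →ₗ[k] V') (v w : V) :
    exteriorPower.map 2 φ (wedge k V v w) = wedge k V' (φ v) (φ w) := by
  rw [← ιMulti_two, exteriorPower.map_apply_ιMulti, ← ιMulti_two]
  congr 1; ext i; fin_cases i <;> rfl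

theorem pairingDual_wedge (a b : Module.Dual k V) (v w : V) :
    exteriorPower.pairingDual k V 2 (wedge k _ a b) (wedge k V v w) = a v * b w - a w * b v := by
  rw [← ιMulti_two, ← ιMulti_two, exteriorPower.pairingDual_ιMulti_ιMulti, Matrix.det_fin_two]
  simp [mul_comm]

theorem d3_tmul_wedge (f : S k V) (a b c : V) :
    d3 k V (f ⊗ₜ exteriorPower.ιMulti k 3 ![a, b, c]) =
      (f * SymmetricAlgebra.ι k V a) ⊗ₜ[k] wedge k V b c
      - (f * SymmetricAlgebra.ι k V b) ⊗ₜ[k] wedge k V a c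
      + (f * SymmetricAlgebra.ι k V c) ⊗ₜ[k] wedge k V a b :=
  d3_tmul k V f a b c

/-- The subspace `L ∧ M` of `⋀² V`. -/
def wedgeSpan (L M : Submodule k V) : Submodule k (⋀[k]^2 V) :=
  Submodule.span k {x | ∃ u ∈ L, ∃ v ∈ M, x = wedge k V u v}

theorem wedge_mem_wedgeSpan {L M : Submodule k V} {u v : V} (hu : u ∈ L) (hv : v ∈ M) :
    wedge k V u v ∈ wedgeSpan L M :=
  Submodule.subset_span ⟨u, hu, v, hv, rfl⟩

theorem wedgeSpan_le {L M : Submodule k V} {N : Submodule k (⋀[k]^2 V)}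
    (h : ∀ u ∈ L, ∀ v ∈ M, wedge k V u v ∈ N) : wedgeSpan L M ≤ N :=
  Submodule.span_le.mpr (by rintro _ ⟨u, hu, v, hv, rfl⟩; exact h u hu v hv)

end Wedge

/-! ### Separability and non-resonance, dualized to inclusions in `⋀² V` -/

section DualSeparability

variable {k : Type*} [Field k] {V : Type*} [AddCommGroup V] [Module k V]

theorem mem_perp_iff {K : Submodule k (⋀[k]^2 V)} {η : ⋀[k]^2 (Module.Dual k V)} :
    η ∈ perp K ↔ ∀ x ∈ K, exteriorPower.pairingDual k V 2 η x = 0 := by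
  rw [perp, Submodule.mem_comap, Submodule.mem_dualAnnihilator]

theorem pairingDual_wedgeSq {U : Submodule k (Module.Dual k V)} {η : ⋀[k]^2 (Module.Dual k V)}
    (hη : η ∈ wedgeSq U) {u : V} (hu : u ∈ U.dualCoannihilator) (v : V) :
    exteriorPower.pairingDual k V 2 η (wedge k V u v) = 0 := by
  rw [Submodule.mem_dualCoannihilator] at hu
  have : wedgeSq U ≤ LinearMap.ker
      ((exteriorPower.pairingDual k V 2).flip (wedge k V u v)) := by
    refine Submodule.span_le.mpr ?_
    rintro _ ⟨a, ha, b, hb, rfl⟩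
    rw [SetLike.mem_coe, LinearMap.mem_ker, LinearMap.flip_apply, ιMulti_two, pairingDual_wedge,
      hu a ha, hu b hb]
    ring
  exact this hη

theorem mem_of_forall_dual {M : Type*} [AddCommGroup M] [Module k M]
    {N : Submodule k M} {x : M}
    (h : ∀ f : Module.Dual k M, (∀ y ∈ N, f y = 0) → f x = 0) : x ∈ N := by
  rw [← Subspace.dualAnnihilator_dualCoannihilator_eq (W := N), Submodule.mem_dualCoannihilator]
  exact fun f hf => h f ((Submodule.mem_dualAnnihilator f).mp hf)

theorem wedgeSpan_ker_top {a : Module.Dual k V} (ha : a ≠ 0) :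
    wedgeSpan (LinearMap.ker a) ⊤ = ⊤ := by
  obtain ⟨e, he⟩ := LinearMap.surjective ha 1
  have hker : ∀ v, v - a v • e ∈ LinearMap.ker a := fun v => by simp [he]
  rw [eq_top_iff, ← span_wedge_eq_top]
  refine Submodule.span_le.mpr ?_
  rintro _ ⟨v, w, rfl⟩
  have : wedge k V v w = wedge k V (v - a v • e) w - a v • wedge k V (w - a w • e) e := by
    simp only [map_sub, LinearMap.sub_apply, map_smul, LinearMap.smul_apply, wedge_self,
      wedge_swap w e]
    simp
  rw [SetLike.mem_coe, this]
  exact sub_mem (wedge_mem_wedgeSpan (hker v) trivial)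
    (Submodule.smul_mem _ _ (wedge_mem_wedgeSpan (hker w) trivial))

/-- A functional on `⋀² V` that kills `⋀² (ker a)` has the form `a ∧ b`. If it also kills `K`, then
`a ∧ b ∈ K^⊥`, which must be zero because `a` is not resonant. -/
theorem wedgeSpan_ker_top_le {K : Submodule k (⋀[k]^2 V)} {a : Module.Dual k V}
    (ha : a ∉ resonance K) :
    wedgeSpan (LinearMap.ker a) ⊤ ≤
      K ⊔ wedgeSpan (LinearMap.ker a) (LinearMap.ker a) := by
  rw [resonance, Set.mem_union, not_or, Set.mem_singleton_iff] at ha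
  obtain ⟨hres, ha⟩ := ha
  refine Koszul.wedgeSpan_le fun u hu v _ => mem_of_forall_dual fun f hf => ?_
  obtain ⟨e, he⟩ := LinearMap.surjective ha 1
  -- Contracting `f` with a vector `e` such that `a(e) = 1` recovers the second factor of `f = a ∧
  -- b`.
  set b : Module.Dual k V := f ∘ₗ wedge k V e with hb
  have hker : ∀ v, v - a v • e ∈ LinearMap.ker a := fun v => by simp [he]
  have hpair : exteriorPower.pairingDual k V 2 (wedge k _ a b) = f := by
    refine wedge_hom_ext fun v w => ?_
    have h0 := hf _ (Submodule.mem_sup_right (wedge_mem_wedgeSpan (hker v) (hker w)))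
    simp only [map_sub, LinearMap.sub_apply, map_smul, LinearMap.smul_apply, wedge_self,
      wedge_swap v e, map_neg, smul_eq_mul, mul_zero, map_zero] at h0
    rw [pairingDual_wedge, hb, LinearMap.comp_apply, LinearMap.comp_apply]
    linear_combination -h0
  have hz : wedge k _ a b = 0 := by
    by_contra hne
    refine hres ⟨b, mem_perp_iff.mpr fun x hx => ?_, hne⟩
    rw [ιMulti_two, hpair]
    exact hf x (Submodule.mem_sup_left hx)
  rw [← hpair, hz]
  simp

variable [FiniteDimensional k V]

/-- The degree two part of `⟨U⟩_E` contains every form vanishing on `⋀² L`, where `L` is the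
annihilator of `U`. With a projection `p` onto `L` and `q = 1 - p`, such a form satisfies `f(u ∧ v)
= f(qu ∧ v) + f(pu ∧ qv)`, and each linear form composed with `q` lies in `U`. -/
theorem exists_mem_idealSpan_pairingDual_eq [CharZero k] (U : Submodule k (Module.Dual k V))
    (f : Module.Dual k (⋀[k]^2 V))
    (hf : ∀ x ∈ wedgeSpan U.dualCoannihilator U.dualCoannihilator, f x = 0) :
    ∃ η : ⋀[k]^2 (Module.Dual k V), exteriorPower.pairingDual k V 2 η = f ∧
      (η : ExteriorAlgebra k (Module.Dual k V)) ∈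
        TwoSidedIdeal.span (ExteriorAlgebra.ι k '' (U : Set (Module.Dual k V))) := by
  set L := U.dualCoannihilator with hL
  obtain ⟨p₀, hp₀⟩ := L.subtype.exists_leftInverse_of_injective (LinearMap.ker_eq_bot.mpr L.injective_subtype)
  set p : V →ₗ[k] V := L.subtype ∘ₗ p₀ with hp
  have hpL : ∀ v, p v ∈ L := fun v => (p₀ v).2
  have hpid : ∀ v ∈ L, p v = v := fun v hv =>
    congrArg Subtype.val (LinearMap.congr_fun hp₀ ⟨v, hv⟩)
  set q : V →ₗ[k] V := LinearMap.id - p with hq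
  have hqU : ∀ a : Module.Dual k V, a ∘ₗ q ∈ U := by
    intro a
    rw [← Subspace.dualCoannihilator_dualAnnihilator_eq (W := U), Submodule.mem_dualAnnihilator]
    intro w hw
    simp [hq, hpid w hw]
  have hsplit : ∀ v, p v + q v = v := fun v => by simp [hq]
  set b := Module.finBasis k V
  set c := fun i j => f (wedge k V (b i) (b j)) with hc
  have hsum : ∀ u v, ∑ i, ∑ j, c i j * (b.coord i u * b.coord j v) = f (wedge k V u v) := by
    intro u v
    conv_rhs => rw [← b.sum_repr u, ← b.sum_repr v]
    simp only [map_sum, LinearMap.sum_apply, map_smul, LinearMap.smul_apply, smul_eq_mul, hc,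
      Module.Basis.coord_apply]
    rw [Finset.sum_comm]
    simp only [Finset.mul_sum]
    refine Finset.sum_congr rfl fun i _ => Finset.sum_congr rfl fun j _ => by ring
  have hcalc : ∀ u v, f (wedge k V (q u) v) + f (wedge k V (p u) (q v)) = f (wedge k V u v) := by
    intro u v
    have h0 := hf _ (wedge_mem_wedgeSpan (hpL u) (hpL v))
    have e : wedge k V u v = wedge k V (q u) v + wedge k V (p u) (q v)
        + wedge k V (p u) (p v) := by
      rw [add_assoc, ← map_add, add_comm (q v), hsplit, ← LinearMap.add_apply, ← map_add,
        add_comm (q u), hsplit]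
    rw [e, map_add, map_add, h0, add_zero]
  -- The pairing antisymmetrizes the bilinear expansion of `f`, which is already alternating, and so
  -- doubles it; hence the factor `2⁻¹`.
  refine ⟨(2⁻¹ : k) • ∑ i, ∑ j, c i j • (wedge k _ (b.coord i ∘ₗ q) (b.coord j) +
    wedge k _ (b.coord i ∘ₗ p) (b.coord j ∘ₗ q)), wedge_hom_ext fun u v => ?_, ?_⟩
  · simp only [map_smul, map_sum, map_add, LinearMap.smul_apply, LinearMap.sum_apply,
      LinearMap.add_apply, pairingDual_wedge, LinearMap.comp_apply, smul_eq_mul, mul_add, mul_sub,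
      Finset.sum_add_distrib, Finset.sum_sub_distrib, hsum]
    have h1 := hcalc u v
    have h2 := hcalc v u
    rw [wedge_swap v u, map_neg] at h2
    linear_combination (2⁻¹ : k) * h1 - (2⁻¹ : k) * h2 +
      (f (wedge k V u v)) * (mul_inv_cancel₀ (two_ne_zero : (2 : k) ≠ 0))
  · set I := TwoSidedIdeal.span (ExteriorAlgebra.ι k '' (U : Set (Module.Dual k V)))
    have hι : ∀ a ∈ U, ExteriorAlgebra.ι k a ∈ I := fun a ha =>
      TwoSidedIdeal.subset_span ⟨a, ha, rfl⟩
    have hcoe : ∀ x y : Module.Dual k V,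
        ((wedge k _ x y : ⋀[k]^2 (Module.Dual k V)) : ExteriorAlgebra k (Module.Dual k V)) =
          ExteriorAlgebra.ι k x * ExteriorAlgebra.ι k y := by
      intro x y
      rw [← ιMulti_two, exteriorPower.ιMulti_apply_coe, ExteriorAlgebra.ιMulti_apply]
      simp
    have hsm : ∀ (r : k) (x : ExteriorAlgebra k (Module.Dual k V)), x ∈ I → r • x ∈ I := by
      intro r x hx
      rw [Algebra.smul_def]
      exact I.mul_mem_left _ _ hx
    simp only [Submodule.coe_smul, Submodule.coe_sum, Submodule.coe_add, hcoe]
    refine hsm _ _ (sum_mem fun i _ => sum_mem fun j _ => hsm _ _ (I.add_mem ?_ ?_))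
    · exact I.mul_mem_right _ _ (hι _ (hqU _))
    · exact I.mul_mem_left _ _ (hι _ (hqU _))

/-- The dual form of separability of a subspace with respect to `K`. -/
theorem IsSeparableSubspace.wedgeSpan_le [CharZero k] {K : Submodule k (⋀[k]^2 V)}
    {U : Submodule k (Module.Dual k V)} (h : IsSeparableSubspace K U) :
    wedgeSpan U.dualCoannihilator ⊤ ≤
      K ⊔ wedgeSpan U.dualCoannihilator U.dualCoannihilator := by
  -- A functional killing `K + ⋀² L` comes from some `η ∈ K^⊥ ∩ ⟨U⟩_E`; separability puts `η` in `⋀²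
  -- U`, and such elements kill `L ∧ V`.
  refine Koszul.wedgeSpan_le fun u hu v _ => mem_of_forall_dual fun f hf => ?_
  obtain ⟨η, rfl, hη⟩ := exists_mem_idealSpan_pairingDual_eq U f
    fun x hx => hf x (Submodule.mem_sup_right hx)
  exact pairingDual_wedgeSq
    (h η (mem_perp_iff.mpr fun x hx => hf x (Submodule.mem_sup_left hx)) hη) hu v

end DualSeparability

/-- Cayley–Hamilton for multiplication by `e` on `P`, with the `I`-adic control of the coefficients
kept. -/
theorem exists_monic_eval_smul_eq_zero {R M : Type*} [CommRing R] [AddCommGroup M] [Module R M]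
    {P : Submodule R M} (hP : P.FG) {I : Ideal R} {e : R} (h : ∀ w ∈ P, e • w ∈ I • P) :
    ∃ p : Polynomial R, p.Monic ∧ (∀ j, p.coeff j ∈ I ^ (p.natDegree - j)) ∧
      ∀ w ∈ P, p.eval e • w = 0 := by
  have : Module.Finite R P := Module.Finite.iff_fg.mpr hP
  set f : Module.End R P := algebraMap _ _ e with hf
  have hrange : LinearMap.range f ≤ I • ⊤ := by
    rintro _ ⟨x, rfl⟩
    have hm : I • P = (I • (⊤ : Submodule R P)).map P.subtype := by
      rw [Submodule.map_smul'', Submodule.map_top, Submodule.range_subtype]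
    have h' := h x x.2
    rw [hm] at h'
    obtain ⟨y, hy, hyx⟩ := h'
    have : f x = y := Subtype.ext hyx.symm
    rwa [this]
  obtain ⟨p, hp, -, hcoeff, hzero⟩ :=
    LinearMap.exists_monic_and_natDegree_eq_and_coeff_mem_pow_and_aeval_eq_zero R f I hrange
  refine ⟨p, hp, hcoeff, fun w hw => ?_⟩
  rw [hf, Polynomial.aeval_algebraMap_apply_eq_algebraMap_eval] at hzero
  exact congrArg Subtype.val (LinearMap.congr_fun hzero ⟨w, hw⟩)

/-! ### Local vanishing of the submodules generated by `L ∧ V` -/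

section LocalAnnihilation

variable {k : Type*} [Field k] {V : Type*} [AddCommGroup V] [Module k V]

/-- The submodule of `W(V,K)` generated by the classes of the elements of a subspace of `⋀² V`. -/
noncomputable def classSpan (K N : Submodule k (⋀[k]^2 V)) : Submodule (S k V) (W K) :=
  Submodule.span (S k V) ((fun x => ofWedge K (1 ⊗ₜ x)) '' N)

theorem ofWedge_tmul_mem_classSpan {K N : Submodule k (⋀[k]^2 V)} (f : S k V) {x : ⋀[k]^2 V}
    (hx : x ∈ N) : ofWedge K (f ⊗ₜ x) ∈ classSpan K N := by
  have : f ⊗ₜ[k] x = f • ((1 : S k V) ⊗ₜ[k] x) := by simp [TensorProduct.smul_tmul']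
  rw [this, map_smul]
  exact Submodule.smul_mem _ _ (Submodule.subset_span ⟨x, hx, rfl⟩)

theorem classSpan_le {K N : Submodule k (⋀[k]^2 V)} {P : Submodule (S k V) (W K)}
    (h : ∀ x ∈ N, ofWedge K (1 ⊗ₜ x) ∈ P) : classSpan K N ≤ P :=
  Submodule.span_le.mpr (by rintro _ ⟨x, hx, rfl⟩; exact h x hx)

variable [CharZero k] [FiniteDimensional k V]

theorem ofWedge_d3 (K : Submodule k (⋀[k]^2 V)) (x : S k V ⊗[k] (⋀[k]^3 V)) :
    ofWedge K (d3 k V x) = 0 := by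
  rw [← LinearMap.mem_ker, ker_ofWedge]
  exact ⟨(x, 0), by simp [presMap]⟩

theorem ofWedge_tmul_of_mem {K : Submodule k (⋀[k]^2 V)} (f : S k V) {x : ⋀[k]^2 V}
    (hx : x ∈ K) : ofWedge K (f ⊗ₜ x) = 0 := by
  rw [← LinearMap.mem_ker, ker_ofWedge]
  exact ⟨(0, f ⊗ₜ ⟨x, hx⟩), by simp [presMap]⟩

theorem classSpan_le_of_le_sup {K N N' : Submodule k (⋀[k]^2 V)} (h : N ≤ K ⊔ N') :
    classSpan K N ≤ classSpan K N' := by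
  refine classSpan_le fun x hx => ?_
  obtain ⟨y, hy, z, hz, rfl⟩ := Submodule.mem_sup.mp (h hx)
  rw [TensorProduct.tmul_add, map_add, ofWedge_tmul_of_mem _ hy, zero_add]
  exact ofWedge_tmul_mem_classSpan _ hz

theorem classSpan_top (K : Submodule k (⋀[k]^2 V)) : classSpan K ⊤ = ⊤ := by
  rw [eq_top_iff]
  rintro w -
  obtain ⟨x, rfl⟩ := ofWedge_surjective K w
  induction x with
  | zero => simp
  | add a b ha hb => rw [map_add]; exact add_mem ha hb
  | tmul f x => exact ofWedge_tmul_mem_classSpan f trivial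

/-- The hypothesis reduces generators to `u ∧ v` with both factors in `L`. The image of `u ∧ v ∧ e`
under `δ₃` is zero in `W(V,K)`, so `e (u ∧ v) = v (u ∧ e) - u (v ∧ e)`, whose coefficients lie in
`L`. -/
theorem ι_smul_mem_linIdeal_smul {K : Submodule k (⋀[k]^2 V)} {L : Submodule k V}
    (hL : wedgeSpan L ⊤ ≤ K ⊔ wedgeSpan L L) (e : V) {w : W K}
    (hw : w ∈ classSpan K (wedgeSpan L ⊤)) :
    SymmetricAlgebra.ι k V e • w ∈ linIdeal k V L • classSpan K (wedgeSpan L ⊤) := by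
  set T := linIdeal k V L • classSpan K (wedgeSpan L ⊤)
  have hgen : ∀ u ∈ L, ∀ v ∈ L,
      SymmetricAlgebra.ι k V e • ofWedge K (1 ⊗ₜ wedge k V u v) ∈ T := by
    intro u hu v hv
    have h0 := ofWedge_d3 K (1 ⊗ₜ exteriorPower.ιMulti k 3 ![u, v, e])
    have hsm : ∀ (v : V) (x : ⋀[k]^2 V), ofWedge K ((1 * SymmetricAlgebra.ι k V v) ⊗ₜ x) =
        SymmetricAlgebra.ι k V v • ofWedge K (1 ⊗ₜ x) := by
      intro v x
      rw [← map_smul, TensorProduct.smul_tmul', one_mul, smul_eq_mul, mul_one]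
    rw [d3_tmul_wedge, map_add, map_sub, hsm, hsm, hsm] at h0
    rw [← neg_eq_iff_add_eq_zero, neg_sub] at h0
    rw [← h0]
    exact sub_mem
      (Submodule.smul_mem_smul (ι_mem_linIdeal hv)
        (ofWedge_tmul_mem_classSpan _ (wedge_mem_wedgeSpan hu trivial)))
      (Submodule.smul_mem_smul (ι_mem_linIdeal hu)
        (ofWedge_tmul_mem_classSpan _ (wedge_mem_wedgeSpan hv trivial)))
  have hle : classSpan K (wedgeSpan L L) ≤
      T.comap (LinearMap.lsmul (S k V) (W K) (SymmetricAlgebra.ι k V e)) := by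
    refine classSpan_le fun x hx => ?_
    induction hx using Submodule.span_induction with
    | mem x hx => obtain ⟨u, hu, v, hv, rfl⟩ := hx; exact hgen u hu v hv
    | zero => simp
    | add a b _ _ ha hb => rw [TensorProduct.tmul_add, map_add]; exact add_mem ha hb
    | smul c a _ ha =>
      have : (1 : S k V) ⊗ₜ[k] (c • a) = algebraMap k (S k V) c • (1 ⊗ₜ[k] a) := by
        rw [TensorProduct.smul_tmul', TensorProduct.tmul_smul, TensorProduct.smul_tmul',
          Algebra.smul_def, smul_eq_mul]
      rw [this, map_smul]
      exact Submodule.smul_mem _ _ ha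
  exact hle (classSpan_le_of_le_sup hL hw)

/-- If `L ∧ V ⊆ K + ⋀² L`, the submodule of `W(V,K)` generated by `L ∧ V` vanishes locally at every
nonzero point of the annihilator of `L`. -/
theorem exists_smul_classSpan_eq_zero {K : Submodule k (⋀[k]^2 V)} {L : Submodule k V}
    (hL : wedgeSpan L ⊤ ≤ K ⊔ wedgeSpan L L) {a : Module.Dual k V} (ha : a ≠ 0)
    (haL : ∀ v ∈ L, a v = 0) :
    ∃ s : S k V, SymmetricAlgebra.lift a s ≠ 0 ∧
      ∀ w ∈ classSpan K (wedgeSpan L ⊤), s • w = 0 := by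
  obtain ⟨e, he⟩ := LinearMap.surjective ha 1
  obtain ⟨p, hp, hcoeff, hzero⟩ := exists_monic_eval_smul_eq_zero (IsNoetherian.noetherian _)
    fun w hw => ι_smul_mem_linIdeal_smul hL e hw
  refine ⟨p.eval (SymmetricAlgebra.ι k V e), ?_, hzero⟩
  -- Coefficients below the leading one lie in a positive power of `I_L`, hence vanish at `a`; only
  -- the leading term `a(e) ^ deg p = 1` survives.
  have hlow : ∀ j ∈ Finset.range p.natDegree, SymmetricAlgebra.lift a
      (p.coeff j * SymmetricAlgebra.ι k V e ^ j) = 0 := by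
    intro j hj
    have hj' : p.natDegree - j ≠ 0 := by have := Finset.mem_range.mp hj; omega
    rw [map_mul, lift_eq_zero_of_mem_linIdeal haL (Ideal.pow_le_self hj' (hcoeff j)), zero_mul]
  rw [Polynomial.eval_eq_sum_range, map_sum, Finset.sum_range_succ, Finset.sum_eq_zero hlow,
    zero_add, hp.coeff_natDegree, one_mul, map_pow, SymmetricAlgebra.lift_ι_apply, he, one_pow]
  exact one_ne_zero

end LocalAnnihilation

/-! ### The kernel of the map to one summand -/

section Kernel

variable {k : Type*} [Field k] {V V' : Type*} [AddCommGroup V] [Module k V]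
  [AddCommGroup V'] [Module k V']

theorem sub_map_mem_wedgeSpan_ker {φ : V →ₗ[k] V'} {σ : V' →ₗ[k] V}
    (hσ : φ ∘ₗ σ = LinearMap.id) (x : ⋀[k]^2 V) :
    x - exteriorPower.map 2 σ (exteriorPower.map 2 φ x) ∈ wedgeSpan (LinearMap.ker φ) ⊤ := by
  have hx : x ∈ Submodule.span k {x | ∃ v w : V, x = wedge k V v w} := by
    rw [span_wedge_eq_top]; trivial
  have hker : ∀ v, v - σ (φ v) ∈ LinearMap.ker φ := fun v => by
    have := LinearMap.congr_fun hσ (φ v)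
    simp at this
    simp [this]
  induction hx using Submodule.span_induction with
  | mem x hx =>
    obtain ⟨v, w, rfl⟩ := hx
    rw [map_wedge, map_wedge]
    have : wedge k V v w - wedge k V (σ (φ v)) (σ (φ w)) =
        wedge k V (v - σ (φ v)) w - wedge k V (w - σ (φ w)) (σ (φ v)) := by
      rw [wedge_swap _ (σ (φ v))]
      simp only [map_sub, LinearMap.sub_apply]
      abel
    rw [this]
    exact sub_mem (wedge_mem_wedgeSpan (hker v) trivial) (wedge_mem_wedgeSpan (hker w) trivial)
  | zero => simp
  | add a b _ _ ha hb =>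
    rw [map_add, map_add, add_sub_add_comm]
    exact add_mem ha hb
  | smul c a _ ha =>
    rw [map_smul, map_smul, ← smul_sub]
    exact Submodule.smul_mem _ _ ha

/-- After subtracting a relation, a class in the kernel has a representative `z` killed by `⋀² φ ⊗
id`. For a section `σ` of `φ`, `z` equals its difference from the image of `z` under `⋀² (σ φ) ⊗
id`, which lies in the span of `ker φ ∧ V`. -/
theorem ker_toWtilde_le [CharZero k] [FiniteDimensional k V] {φ : V →ₗ[k] V'}
    (hφ : Function.Surjective φ) (K : Submodule k (⋀[k]^2 V)) :
    LinearMap.ker (toWtilde φ K) ≤ classSpan K (wedgeSpan (LinearMap.ker φ) ⊤) := by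
  intro w hw
  obtain ⟨x, rfl⟩ := ofWedge_surjective K w
  rw [LinearMap.mem_ker, toWtilde_ofWedge, Submodule.Quotient.mk_eq_zero] at hw
  obtain ⟨y, hy⟩ := hw
  set z := x - presMap K y with hz
  have hzx : ofWedge K z = ofWedge K x := by
    rw [hz, map_sub, sub_eq_self, ← LinearMap.mem_ker, ker_ofWedge]
    exact ⟨y, rfl⟩
  have hz0 : (exteriorPower.map 2 φ).baseChange (S k V) z = 0 := by
    rw [hz, map_sub, ← hy, LinearMap.comp_apply, sub_self]
  obtain ⟨σ, hσ⟩ := φ.exists_rightInverse_of_surjective (LinearMap.range_eq_top.mpr hφ)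
  have key : ∀ z : S k V ⊗[k] (⋀[k]^2 V),
      ofWedge K (z - (exteriorPower.map 2 σ).baseChange (S k V)
        ((exteriorPower.map 2 φ).baseChange (S k V) z)) ∈
        classSpan K (wedgeSpan (LinearMap.ker φ) ⊤) := by
    intro z
    induction z with
    | zero => simp
    | add a b ha hb =>
      rw [map_add, map_add, add_sub_add_comm, map_add]
      exact add_mem ha hb
    | tmul f x =>
      rw [LinearMap.baseChange_tmul, LinearMap.baseChange_tmul, ← TensorProduct.tmul_sub]
      exact ofWedge_tmul_mem_classSpan f (sub_map_mem_wedgeSpan_ker hσ x)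
  have := key z
  rwa [hz0, map_zero, sub_zero, hzx] at this

end Kernel

/-! ### Graded pieces and Artin–Rees -/

section Grading

variable {k : Type*} [Field k] {V : Type*} [AddCommGroup V] [Module k V]

theorem symPow_succ_le {q : ℕ} {N : Submodule k (S k V)}
    (h : ∀ v, ∀ f ∈ symPow k V q, SymmetricAlgebra.ι k V v * f ∈ N) : symPow k V (q + 1) ≤ N := by
  rw [symPow, pow_succ', Submodule.mul_le]
  rintro _ ⟨v, rfl⟩ f hf
  exact h v f hf

theorem ι_mul_mem_symPow {q : ℕ} (v : V) {f : S k V} (hf : f ∈ symPow k V q) :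
    SymmetricAlgebra.ι k V v * f ∈ symPow k V (q + 1) := by
  rw [symPow, pow_succ']
  exact Submodule.mul_mem_mul ⟨v, rfl⟩ hf

theorem mul_ι_mem_symPow {q : ℕ} (v : V) {f : S k V} (hf : f ∈ symPow k V q) :
    f * SymmetricAlgebra.ι k V v ∈ symPow k V (q + 1) := by
  rw [mul_comm]
  exact ι_mul_mem_symPow v hf

theorem symPow_zero_le {N : Submodule k (S k V)} (h : (1 : S k V) ∈ N) : symPow k V 0 ≤ N := by
  rw [symPow, pow_zero]
  exact Submodule.one_le.mpr h

theorem symPow_le_linIdeal_top_pow (q : ℕ) :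
    symPow k V q ≤ (linIdeal k V ⊤ ^ q).restrictScalars k := by
  induction q with
  | zero => exact symPow_zero_le (by simp)
  | succ q ih =>
    refine symPow_succ_le fun v f hf => ?_
    rw [Submodule.restrictScalars_mem, pow_succ']
    exact Ideal.mul_mem_mul (ι_mem_linIdeal trivial) (ih hf)

instance finite_symPow [FiniteDimensional k V] (q : ℕ) : Module.Finite k (symPow k V q) :=
  Module.Finite.iff_fg.mpr ((Module.Finite.iff_fg.mp inferInstance).pow q)

variable {M : Type*} [AddCommGroup M] [Module k M]

instance finite_symPart [FiniteDimensional k V] [FiniteDimensional k M] (q : ℕ) :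
    Module.Finite k (symPart k V M q) :=
  Module.Finite.range _

theorem tmul_mem_symPart {q : ℕ} {f : S k V} (hf : f ∈ symPow k V q) (m : M) :
    f ⊗ₜ m ∈ symPart k V M q :=
  ⟨⟨f, hf⟩ ⊗ₜ m, rfl⟩

theorem symPart_le {q : ℕ} {N : Submodule k (S k V ⊗[k] M)}
    (h : ∀ f ∈ symPow k V q, ∀ m, f ⊗ₜ m ∈ N) : symPart k V M q ≤ N := by
  rintro _ ⟨x, rfl⟩
  induction x with
  | zero => simp
  | add a b ha hb => rw [map_add]; exact add_mem ha hb
  | tmul f m => exact h f f.2 m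

theorem symPart_wedge_le {q : ℕ} {N : Submodule k (S k V ⊗[k] (⋀[k]^2 V))}
    (h : ∀ f ∈ symPow k V q, ∀ v w, f ⊗ₜ wedge k V v w ∈ N) :
    symPart k V (⋀[k]^2 V) q ≤ N := by
  refine symPart_le fun f hf m => ?_
  have : (⊤ : Submodule k (⋀[k]^2 V)) ≤ N.comap (TensorProduct.mk k (S k V) _ f) := by
    rw [← span_wedge_eq_top, Submodule.span_le]
    rintro _ ⟨v, w, rfl⟩
    exact h f hf v w
  exact this trivial

theorem d2_mem_symPart {q : ℕ} {x : S k V ⊗[k] (⋀[k]^2 V)}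
    (hx : x ∈ symPart k V (⋀[k]^2 V) q) : d2 k V x ∈ symPart k V V (q + 1) := by
  have : symPart k V (⋀[k]^2 V) q ≤
      (symPart k V V (q + 1)).comap ((d2 k V).restrictScalars k) := by
    refine symPart_wedge_le fun f hf v w => ?_
    rw [Submodule.mem_comap, LinearMap.coe_restrictScalars, ← ιMulti_two, d2_tmul]
    exact sub_mem (tmul_mem_symPart (mul_ι_mem_symPow _ hf) _)
      (tmul_mem_symPart (mul_ι_mem_symPow _ hf) _)
  exact this hx

variable [FiniteDimensional k V]

theorem pd_mem_symPow (i) {q : ℕ} {f : S k V} (hf : f ∈ symPow k V (q + 1)) :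
    pd k V i f ∈ symPow k V q := by
  induction q generalizing f with
  | zero =>
    have : symPow k V (0 + 1) ≤ (symPow k V 0).comap (pd k V i) := by
      refine symPow_succ_le fun v f hf => ?_
      have h0 : pd k V i f = 0 := symPow_zero_le (N := LinearMap.ker (pd k V i)) (pd_one k V i) hf
      rw [Submodule.mem_comap, pd_ι_mul, h0, mul_zero, add_zero]
      exact Submodule.smul_mem _ _ hf
    exact this hf
  | succ q ih =>
    have : symPow k V (q + 1 + 1) ≤ (symPow k V (q + 1)).comap (pd k V i) := by
      refine symPow_succ_le fun v f hf => ?_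
      rw [Submodule.mem_comap, pd_ι_mul]
      exact add_mem (Submodule.smul_mem _ _ hf) (ι_mul_mem_symPow v (ih hf))
    exact this hf

theorem eul_of_mem_symPow {q : ℕ} {f : S k V} (hf : f ∈ symPow k V q) :
    eul k V f = (q : k) • f := by
  suffices h : symPow k V q ≤ Module.End.eigenspace (eul k V) (q : k) from
    Module.End.mem_eigenspace_iff.mp (h hf)
  clear hf
  induction q with
  | zero => exact symPow_zero_le (by rw [Module.End.mem_eigenspace_iff, eul_one]; simp)
  | succ q ih =>
    refine symPow_succ_le fun v f hf => ?_
    rw [Module.End.mem_eigenspace_iff, eul_ι_mul, Module.End.mem_eigenspace_iff.mp (ih hf),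
      mul_smul_comm, Nat.cast_succ, add_smul, one_smul, add_comm]

theorem h1_mem_symPart {q : ℕ} {z : S k V ⊗[k] V} (hz : z ∈ symPart k V V (q + 1)) :
    h1 k V z ∈ symPart k V (⋀[k]^2 V) q := by
  have : symPart k V V (q + 1) ≤ (symPart k V (⋀[k]^2 V) q).comap (h1 k V) := by
    refine symPart_le fun f hf v => ?_
    rw [Submodule.mem_comap, h1_tmul]
    exact sum_mem fun i _ => tmul_mem_symPart (pd_mem_symPow i hf) _
  exact this hz

theorem eul_of_mem_symPart {q : ℕ} {z : S k V ⊗[k] M} (hz : z ∈ symPart k V M q) :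
    (eul k V).rTensor M z = (q : k) • z := by
  have : symPart k V M q ≤ Module.End.eigenspace ((eul k V).rTensor M) (q : k) := by
    refine symPart_le fun f hf v => ?_
    rw [Module.End.mem_eigenspace_iff, LinearMap.rTensor_tmul, eul_of_mem_symPow hf,
      TensorProduct.smul_tmul']
  exact Module.End.mem_eigenspace_iff.mp (this hz)

/-- The contracting homotopy `h1` lowers polynomial degree by one, so it lifts a homogeneous cycle
to a homogeneous element of `⋀² V ⊗ Sym^q V`. -/
theorem Wdeg_eq_map [CharZero k] (K : Submodule k (⋀[k]^2 V)) (q : ℕ) :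
    Wdeg K q = (symPart k V (⋀[k]^2 V) q).map ((ofWedge K).restrictScalars k) := by
  ext w
  constructor
  · rintro ⟨z, ⟨hz, hzq⟩, hzw⟩
    have h := d2_h1 k V z
    rw [(show d1 k V z = 0 from hz), map_zero, add_zero, eul_of_mem_symPart hzq] at h
    -- On cycles in `V ⊗ Sym^{q+1} V` the composite `δ₂ h1` is the Euler operator plus the identity,
    -- that is, multiplication by `q + 2`, invertible in characteristic zero.
    have hne : ((q + 1 : ℕ) : k) + 1 ≠ 0 := by exact_mod_cast (q + 1).succ_ne_zero
    refine ⟨(((q + 1 : ℕ) : k) + 1)⁻¹ • h1 k V z,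
      Submodule.smul_mem _ _ (h1_mem_symPart hzq), Subtype.ext ?_⟩
    refine Eq.trans ?_ hzw
    have : d2 k V ((((q + 1 : ℕ) : k) + 1)⁻¹ • h1 k V z) = z := by
      rw [LinearMap.map_smul_of_tower, h]
      nth_rewrite 2 [← one_smul k z]
      rw [← add_smul, smul_smul, inv_mul_cancel₀ hne, one_smul]
    exact congrArg (boundaries K).mkQ this
  · rintro ⟨x, hx, rfl⟩
    exact ⟨d2 k V x, ⟨d1_d2 k V x, d2_mem_symPart hx⟩, rfl⟩

theorem mem_pow_smul_of_mem_Wdeg [CharZero k] {K : Submodule k (⋀[k]^2 V)} {q : ℕ} {w : W K}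
    (hw : w ∈ Wdeg K q) : w ∈ linIdeal k V ⊤ ^ q • (⊤ : Submodule (S k V) (W K)) := by
  rw [Wdeg_eq_map] at hw
  obtain ⟨_, ⟨y, rfl⟩, rfl⟩ := hw
  rw [LinearMap.coe_restrictScalars]
  induction y with
  | zero => rw [map_zero, map_zero]; exact zero_mem _
  | add a b ha hb => rw [map_add, map_add]; exact add_mem ha hb
  | tmul f x =>
    have : (f : S k V) ⊗ₜ[k] x = (f : S k V) • ((1 : S k V) ⊗ₜ[k] x) := by
      rw [TensorProduct.smul_tmul', smul_eq_mul, mul_one]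
    rw [LinearMap.rTensor_tmul, Submodule.subtype_apply, this, map_smul]
    exact Submodule.smul_mem_smul (symPow_le_linIdeal_top_pow q f.2) Submodule.mem_top

/-- Let `m` be the irrelevant ideal, so that `W_q ⊆ m^q W`. Artin–Rees gives `m^q W ∩ N ⊆ m^(q-d) N`
for `q ≥ d`, and this is zero once `q - d ≥ c`. -/
theorem exists_Wdeg_disjoint [CharZero k] (K : Submodule k (⋀[k]^2 V))
    {N : Submodule (S k V) (W K)} {c : ℕ} (hc : linIdeal k V ⊤ ^ c ≤ N.annihilator) :
    ∃ q₀ : ℕ, ∀ q ≥ q₀, ∀ w ∈ Wdeg K q, w ∈ N → w = 0 := by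
  obtain ⟨d, hd⟩ := (linIdeal k V ⊤).exists_pow_inf_eq_pow_smul N
  refine ⟨d + c, fun q hq w hw hwN => ?_⟩
  have hmem : w ∈ linIdeal k V ⊤ ^ q • (⊤ : Submodule (S k V) (W K)) ⊓ N :=
    ⟨mem_pow_smul_of_mem_Wdeg hw, hwN⟩
  rw [hd q (by omega)] at hmem
  have hle : linIdeal k V ⊤ ^ (q - d) ≤ N.annihilator :=
    (Ideal.pow_le_pow_right (by omega)).trans hc
  have := Submodule.smul_mono hle (inf_le_right : _ ≤ N) hmem
  rwa [Submodule.annihilator_smul, Submodule.mem_bot] at this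

end Grading

/-! ### Injectivity of `Π` in large degrees -/

section Injectivity

variable {k : Type*} [Field k] [CharZero k] {V : Type*} [AddCommGroup V] [Module k V]
  [FiniteDimensional k V]

theorem ker_PiMap_le (K : Submodule k (⋀[k]^2 V)) {n : ℕ}
    (U : Fin n → Submodule k (Module.Dual k V)) (t : Fin n) :
    LinearMap.ker (PiMap K U) ≤ classSpan K (wedgeSpan (U t).dualCoannihilator ⊤) := by
  intro w hw
  have h := ker_toWtilde_le (φ := proj (U t)) (Submodule.mkQ_surjective _) K
    (show w ∈ LinearMap.ker (toWtilde (proj (U t)) K) from congrFun hw t)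
  rwa [proj, Submodule.ker_mkQ] at h

theorem exists_injOn_PiMap [IsAlgClosed k] (K : Submodule k (⋀[k]^2 V)) {n : ℕ}
    (U : Fin n → Submodule k (Module.Dual k V)) (hsep : ∀ t, IsSeparableSubspace K (U t))
    (hcover : ∀ a ∈ resonance K, ∃ t, a ∈ U t) :
    ∃ q₀ : ℕ, ∀ q ≥ q₀, Set.InjOn (PiMap K U) (Wdeg K q : Set (W K)) := by
  obtain ⟨c, hc⟩ := exists_pow_linIdeal_top_le (LinearMap.ker (PiMap K U)).annihilator
    fun a ha => by
      -- At a resonant point the component through it supplies `L`; at any other nonzero point `L =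
      -- ker a` works and the whole of `W(V,K)` vanishes locally.
      by_cases hres : a ∈ resonance K
      · obtain ⟨t, ht⟩ := hcover a hres
        obtain ⟨s, hs, hsw⟩ := exists_smul_classSpan_eq_zero (hsep t).wedgeSpan_le ha
          fun v hv => (Submodule.mem_dualCoannihilator _).mp hv a ht
        exact ⟨s, Submodule.mem_annihilator.mpr fun w hw => hsw w (ker_PiMap_le K U t hw), hs⟩
      · obtain ⟨s, hs, hsw⟩ := exists_smul_classSpan_eq_zero (wedgeSpan_ker_top_le hres) ha
          fun v hv => hv
        refine ⟨s, Submodule.mem_annihilator.mpr fun w _ => hsw w ?_, hs⟩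
        rw [wedgeSpan_ker_top ha, classSpan_top]
        trivial
  obtain ⟨q₀, hq₀⟩ := exists_Wdeg_disjoint K hc
  refine ⟨q₀, fun q hq x hx y hy hxy => sub_eq_zero.mp (hq₀ q hq _ (sub_mem hx hy) ?_)⟩
  rw [LinearMap.mem_ker, map_sub]
  exact sub_eq_zero.mpr hxy

end Injectivity

/-! ### Distinct components meet only in the origin -/

section Disjointness

variable {k : Type*} [Field k] {V : Type*} [AddCommGroup V] [Module k V]

/-- The functional `f ⊗ x ↦ f(c) ω(x)` on `⋀² V ⊗ S` attached to a point `c` of `V^∨` and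
`ω ∈ ⋀² V^∨`. -/
noncomputable def evalAt (c : Module.Dual k V) (ω : ⋀[k]^2 (Module.Dual k V)) :
    S k V ⊗[k] (⋀[k]^2 V) →ₗ[k] k :=
  LinearMap.mul' k k ∘ₗ TensorProduct.map (SymmetricAlgebra.lift c).toLinearMap
    (exteriorPower.pairingDual k V 2 ω)

theorem evalAt_tmul (c : Module.Dual k V) (ω : ⋀[k]^2 (Module.Dual k V)) (f : S k V)
    (x : ⋀[k]^2 V) : evalAt c ω (f ⊗ₜ x) =
      SymmetricAlgebra.lift c f * exteriorPower.pairingDual k V 2 ω x := rfl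

/-- The value on `u ∧ v ∧ w` is a multiple of `(c ∧ c ∧ b)(u, v, w) = 0`. Together with `c ∧ b ∈
K^⊥`, this makes the functional vanish on all relations of `W(V,K)`. -/
theorem evalAt_d3 (c b : Module.Dual k V) (x : S k V ⊗[k] (⋀[k]^3 V)) :
    evalAt c (wedge k _ c b) (d3 k V x) = 0 := by
  induction x using tmul_induction with
  | h0 => simp
  | hadd x y hx hy => rw [map_add, map_add, hx, hy, add_zero]
  | hp f v =>
    have : v = ![v 0, v 1, v 2] := by ext i; fin_cases i <;> rfl
    rw [this, d3_tmul_wedge]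
    simp only [map_add, map_sub, evalAt_tmul, pairingDual_wedge, map_mul,
      SymmetricAlgebra.lift_ι_apply]
    ring

theorem evalAt_presMap {K : Submodule k (⋀[k]^2 V)} {c b : Module.Dual k V}
    (h : wedge k _ c b ∈ perp K) (y) : evalAt c (wedge k _ c b) (presMap K y) = 0 := by
  rw [presMap, LinearMap.coprod_apply, map_add, evalAt_d3, zero_add]
  induction y.2 with
  | zero => simp
  | add a b ha hb => rw [map_add, map_add, ha, hb, add_zero]
  | tmul f x =>
    rw [LinearMap.baseChange_tmul, evalAt_tmul, Submodule.subtype_apply,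
      mem_perp_iff.mp h x x.2, mul_zero]

variable [CharZero k]

/-- The restriction of `s` to the line `a + r d` is a polynomial in `r` with nonzero value at `0`,
so it has a nonzero value at some `r ≠ 0` because the field is infinite. -/
theorem exists_lift_add_smul_ne_zero {a : Module.Dual k V} (d : Module.Dual k V) {s : S k V}
    (hs : SymmetricAlgebra.lift a s ≠ 0) :
    ∃ r : k, r ≠ 0 ∧ SymmetricAlgebra.lift (a + r • d) s ≠ 0 := by
  set p : Polynomial k := SymmetricAlgebra.lift (Algebra.linearMap k (Polynomial k) ∘ₗ a +
    LinearMap.mulLeft k Polynomial.X ∘ₗ Algebra.linearMap k (Polynomial k) ∘ₗ d) s with hp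
  have heval : ∀ r : k, p.eval r = SymmetricAlgebra.lift (a + r • d) s := by
    intro r
    have : (Polynomial.aeval r).comp
        (SymmetricAlgebra.lift (Algebra.linearMap k (Polynomial k) ∘ₗ a +
          LinearMap.mulLeft k Polynomial.X ∘ₗ Algebra.linearMap k (Polynomial k) ∘ₗ d)) =
        SymmetricAlgebra.lift (a + r • d) := by
      refine SymmetricAlgebra.algHom_ext (LinearMap.ext fun v => ?_)
      simp
      exact mul_comm _ _
    rw [← this, AlgHom.comp_apply, ← hp, Polynomial.coe_aeval_eq_eval]
  by_contra! hcon
  -- The factor `X` absorbs the value at `r = 0`, about which the contrary assumption says nothing.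
  have hX : Polynomial.X * p = 0 := by
    refine Polynomial.funext fun r => ?_
    rw [Polynomial.eval_mul, Polynomial.eval_X, Polynomial.eval_zero, heval]
    by_cases hr : r = 0
    · rw [hr, zero_mul]
    · rw [hcon r hr, mul_zero]
  have hp0 : p = 0 := (mul_eq_zero.mp hX).resolve_left Polynomial.X_ne_zero
  apply hs
  have := heval 0
  rw [hp0, Polynomial.eval_zero, zero_smul, add_zero] at this
  exact this.symm

variable [FiniteDimensional k V]

/-- Let `L'` be the annihilator of `U'`. Near a nonzero common point the module generated by `L' ∧
V` vanishes, while a nearby `c ∈ U \ U'` is resonant through some `c ∧ b ≠ 0`. Evaluation at `c`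
paired with `c ∧ b` factors through `W(V,K)`, so `c ∧ b` must kill `L' ∧ V`. As `c` is nonzero on
`L'`, this makes `b` proportional to `c`, a contradiction. -/
theorem IsSeparableSubspace.inf_eq_bot {K : Submodule k (⋀[k]^2 V)}
    {U U' : Submodule k (Module.Dual k V)} (hU : (U : Set (Module.Dual k V)) ⊆ resonance K)
    (hU' : IsSeparableSubspace K U') (hne : ¬ U ≤ U') : U ⊓ U' = ⊥ := by
  rw [Submodule.eq_bot_iff]
  rintro a ⟨haU, haU'⟩
  by_contra ha
  obtain ⟨d, hdU, hdU'⟩ := SetLike.not_le_iff_exists.mp hne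
  obtain ⟨s, hs, hsw⟩ := exists_smul_classSpan_eq_zero hU'.wedgeSpan_le ha
    fun v hv => (Submodule.mem_dualCoannihilator _).mp hv a haU'
  obtain ⟨r, hr, hrs⟩ := exists_lift_add_smul_ne_zero d hs
  set c := a + r • d
  have hcU' : c ∉ U' := fun h => hdU'
    ((Submodule.smul_mem_iff _ hr).mp ((Submodule.add_mem_iff_right _ haU').mp h))
  obtain ⟨b, hb, hb0⟩ : ∃ b, wedge k _ c b ∈ perp K ∧ wedge k _ c b ≠ 0 :=
    (hU (U.add_mem haU (U.smul_mem r hdU))).resolve_right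
      fun h => hcU' ((Set.mem_singleton_iff.mp h : c = 0) ▸ U'.zero_mem)
  have hzero : ∀ u ∈ U'.dualCoannihilator, ∀ v, c u * b v - c v * b u = 0 := by
    intro u hu v
    have h0 := hsw _ (ofWedge_tmul_mem_classSpan 1 (wedge_mem_wedgeSpan hu (trivial : v ∈ ⊤)))
    rw [← map_smul, ← LinearMap.mem_ker, ker_ofWedge] at h0
    obtain ⟨y, hy⟩ := h0
    have h1 := evalAt_presMap hb y
    rw [hy, TensorProduct.smul_tmul', evalAt_tmul, smul_eq_mul, mul_one,
      pairingDual_wedge] at h1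
    exact (mul_eq_zero.mp h1).resolve_left hrs
  obtain ⟨u, hu, hcu⟩ : ∃ u ∈ U'.dualCoannihilator, c u ≠ 0 := by
    by_contra! hcon
    apply hcU'
    rw [← Subspace.dualCoannihilator_dualAnnihilator_eq (W := U'), Submodule.mem_dualAnnihilator]
    exact hcon
  apply hb0
  have : b = (b u / c u) • c := by
    ext v
    have := hzero u hu v
    rw [LinearMap.smul_apply, smul_eq_mul]
    field_simp
    linear_combination this
  rw [this, map_smul, wedge_self, smul_zero]

end Disjointness

/-! ### Surjectivity of `Π` -/

section Surjectivity

variable {k : Type*} [Field k] {V : Type*} [AddCommGroup V] [Module k V]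

/-- Each member of `T` costs one degree. Splitting a linear factor as `l + l'` along `L t ⊔ L r`,
and the remaining factor as `g + h` by induction, the part `l' g` lies in all the ideals indexed by
`insert r T`, and the rest `l g + (l + l') h` lies in the ideal of `L t`. -/
theorem symPow_le_inf_sup {ι : Type*} (L : ι → Submodule k V) (t : ι) (T : Finset ι)
    (hT : ∀ t' ∈ T, L t ⊔ L t' = ⊤) {q : ℕ} (hq : T.card ≤ q) :
    symPow k V q ≤ (symPow k V q ⊓ ⨅ t' ∈ T, (linIdeal k V (L t')).restrictScalars k) ⊔
      (linIdeal k V (L t)).restrictScalars k := by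
  classical
  induction T using Finset.induction_on generalizing q with
  | empty => simp
  | insert r T hr ih =>
    rw [Finset.card_insert_of_notMem hr] at hq
    obtain ⟨q, rfl⟩ : ∃ p, q = p + 1 := ⟨q - 1, by omega⟩
    refine symPow_succ_le fun v f hf => ?_
    obtain ⟨g, ⟨hgq, hgT⟩, h, hh, rfl⟩ := Submodule.mem_sup.mp
      (ih (fun t' ht' => hT t' (Finset.mem_insert_of_mem ht')) (by omega) hf)
    obtain ⟨l, hl, l', hl', rfl⟩ := Submodule.mem_sup.mp
      (hT r (Finset.mem_insert_self r T) ▸ Submodule.mem_top : v ∈ L t ⊔ L r)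
    refine Submodule.mem_sup.mpr ⟨SymmetricAlgebra.ι k V l' * g, ⟨ι_mul_mem_symPow _ hgq, ?_⟩,
      SymmetricAlgebra.ι k V l * g + SymmetricAlgebra.ι k V (l + l') * h, ?_, ?_⟩
    · simp only [SetLike.mem_coe, Submodule.mem_iInf] at hgT ⊢
      intro t' ht'
      rcases Finset.mem_insert.mp ht' with rfl | ht'
      · exact Ideal.mul_mem_right _ _ (ι_mem_linIdeal hl')
      · exact Ideal.mul_mem_left _ _ (hgT t' ht')
    · exact add_mem (Ideal.mul_mem_right _ _ (ι_mem_linIdeal hl)) (Ideal.mul_mem_left _ _ hh)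
    · rw [map_add]
      ring

variable {V' : Type*} [AddCommGroup V'] [Module k V']

theorem map_two_surjective {φ : V →ₗ[k] V'} (hφ : Function.Surjective φ) :
    Function.Surjective (exteriorPower.map 2 φ) := by
  rw [← LinearMap.range_eq_top, eq_top_iff, ← span_wedge_eq_top, Submodule.span_le]
  rintro _ ⟨v', w', rfl⟩
  obtain ⟨v, rfl⟩ := hφ v'
  obtain ⟨w, rfl⟩ := hφ w'
  exact ⟨wedge k V v w, map_wedge φ v w⟩

theorem baseChange_map_d3 (φ : V →ₗ[k] V') (f : S k V) (a b c : V) :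
    (exteriorPower.map 2 φ).baseChange (S k V)
      (d3 k V (f ⊗ₜ exteriorPower.ιMulti k 3 ![a, b, c])) =
      (f * SymmetricAlgebra.ι k V a) ⊗ₜ[k] wedge k V' (φ b) (φ c)
      - (f * SymmetricAlgebra.ι k V b) ⊗ₜ[k] wedge k V' (φ a) (φ c)
      + (f * SymmetricAlgebra.ι k V c) ⊗ₜ[k] wedge k V' (φ a) (φ b) := by
  simp only [d3_tmul_wedge, map_add, map_sub, LinearMap.baseChange_tmul, map_wedge]

/-- The relations of `W̃(V', K')`. -/
noncomputable abbrev rel (φ : V →ₗ[k] V') (K : Submodule k (⋀[k]^2 V)) :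
    Submodule (S k V) (S k V ⊗[k] (⋀[k]^2 V')) :=
  LinearMap.range ((exteriorPower.map 2 φ).baseChange (S k V) ∘ₗ presMap K)

theorem baseChange_d3_mem_rel (φ : V →ₗ[k] V') (K : Submodule k (⋀[k]^2 V))
    (y : S k V ⊗[k] (⋀[k]^3 V)) :
    (exteriorPower.map 2 φ).baseChange (S k V) (d3 k V y) ∈ rel φ K :=
  ⟨(y, 0), by simp [presMap]⟩

theorem tmul_map_mem_rel (φ : V →ₗ[k] V') {K : Submodule k (⋀[k]^2 V)} (f : S k V)
    {x : ⋀[k]^2 V} (hx : x ∈ K) : f ⊗ₜ exteriorPower.map 2 φ x ∈ rel φ K :=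
  ⟨(0, f ⊗ₜ ⟨x, hx⟩), by simp [presMap]⟩

/-- For `u ∈ ker φ`, the image of the Koszul relation of `u ∧ v ∧ w` loses every term containing `φ
u` and leaves `u ⊗ (φ v ∧ φ w)`. Hence linear forms in `ker φ` act as zero on `W̃`. -/
theorem smul_mem_rel {φ : V →ₗ[k] V'} (hφ : Function.Surjective φ) (K : Submodule k (⋀[k]^2 V))
    {r : S k V} (hr : r ∈ linIdeal k V (LinearMap.ker φ)) (x : S k V ⊗[k] (⋀[k]^2 V')) :
    r • x ∈ rel φ K := by
  suffices h : linIdeal k V (LinearMap.ker φ) ≤ (rel φ K).colon Set.univ from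
    Submodule.mem_colon.mp (h hr) x trivial
  refine linIdeal_le fun u hu => Submodule.mem_colon.mpr fun x _ => ?_
  obtain ⟨z, rfl⟩ : ∃ z, (exteriorPower.map 2 φ).baseChange (S k V) z = x :=
    LinearMap.lTensor_surjective _ (map_two_surjective hφ) x
  rw [← map_smul]
  induction z using tmul_induction with
  | h0 => simp
  | hadd x y hx hy => rw [smul_add, map_add]; exact add_mem (hx trivial) (hy trivial)
  | hp f v =>
    have hv : v = ![v 0, v 1] := by ext i; fin_cases i <;> rfl
    have h := baseChange_d3_mem_rel φ K (f ⊗ₜ exteriorPower.ιMulti k 3 ![u, v 0, v 1])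
    rw [baseChange_map_d3, LinearMap.mem_ker.mp hu] at h
    rw [hv, ιMulti_two, TensorProduct.smul_tmul', LinearMap.baseChange_tmul, map_wedge,
      smul_eq_mul, mul_comm]
    simpa using h

variable [FiniteDimensional k V]

theorem sup_dualCoannihilator_eq_top {U U' : Submodule k (Module.Dual k V)} (h : U ⊓ U' = ⊥) :
    U.dualCoannihilator ⊔ U'.dualCoannihilator = ⊤ := by
  rw [← Subspace.dualAnnihilator_inj, Submodule.dualAnnihilator_sup_eq,
    Subspace.dualCoannihilator_dualAnnihilator_eq, Subspace.dualCoannihilator_dualAnnihilator_eq,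
    h, Submodule.dualAnnihilator_top]

variable [CharZero k]

theorem PiMap_ofWedge (K : Submodule k (⋀[k]^2 V)) {n : ℕ}
    (U : Fin n → Submodule k (Module.Dual k V)) (x : S k V ⊗[k] (⋀[k]^2 V)) (t : Fin n) :
    PiMap K U (ofWedge K x) t =
      Submodule.Quotient.mk ((exteriorPower.map 2 (proj (U t))).baseChange (S k V) x) :=
  toWtilde_ofWedge _ _ _

theorem mapsTo_PiMap (K : Submodule k (⋀[k]^2 V)) {n : ℕ}
    (U : Fin n → Submodule k (Module.Dual k V)) (q : ℕ) :
    Set.MapsTo (PiMap K U) (Wdeg K q : Set (W K))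
      {w | ∀ t, w t ∈ WtildeDeg (proj (U t)) K q} := by
  intro w hw t
  rw [Wdeg_eq_map] at hw
  obtain ⟨x, hx, rfl⟩ := hw
  refine ⟨(exteriorPower.map 2 (proj (U t))).baseChange (S k V) x, ?_,
    (PiMap_ofWedge K U x t).symm⟩
  have : symPart k V (⋀[k]^2 V) q ≤ (symPart k V _ q).comap
      (((exteriorPower.map 2 (proj (U t))).baseChange (S k V)).restrictScalars k) :=
    symPart_le fun f hf m => tmul_mem_symPart hf _
  exact this hx

theorem surjOn_PiMap (K : Submodule k (⋀[k]^2 V)) {n : ℕ}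
    (U : Fin n → Submodule k (Module.Dual k V)) (hU : ∀ t t', t ≠ t' → U t ⊓ U t' = ⊥)
    {q : ℕ} (hq : n ≤ q) :
    Set.SurjOn (PiMap K U) (Wdeg K q : Set (W K))
      {w | ∀ t, w t ∈ WtildeDeg (proj (U t)) K q} := by
  classical
  set Q := (Wdeg K q).map ((PiMap K U).restrictScalars k) with hQ
  suffices h : ∀ t, WtildeDeg (proj (U t)) K q ≤
      Q.comap (LinearMap.single k (fun t => Wtilde (proj (U t)) K) t) by
    intro w hw
    have : w ∈ Q := by
      rw [← Finset.univ_sum_single w]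
      exact sum_mem fun t _ => h t (hw t)
    exact this
  intro t
  have hsup : ∀ t' ∈ Finset.univ.erase t,
      (U t).dualCoannihilator ⊔ (U t').dualCoannihilator = ⊤ := fun t' ht' =>
    sup_dualCoannihilator_eq_top (hU t t' (Finset.ne_of_mem_erase ht').symm)
  have hcard : (Finset.univ.erase t).card ≤ q :=
    (Finset.card_le_univ _).trans (by simpa using hq)
  have hker : ∀ t, (U t).dualCoannihilator = LinearMap.ker (proj (U t)) := fun t => by
    rw [proj, Submodule.ker_mkQ]
  rw [WtildeDeg, Submodule.map_le_iff_le_comap]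
  refine symPart_le fun f hf y => ?_
  obtain ⟨x, rfl⟩ := map_two_surjective (φ := proj (U t)) (Submodule.mkQ_surjective _) y
  obtain ⟨g, ⟨hgq, hg⟩, h, hh, rfl⟩ := Submodule.mem_sup.mp
    (symPow_le_inf_sup (fun t => (U t).dualCoannihilator) t _ hsup hcard hf)
  -- The part `g` agrees with `g + h` modulo the ideal killing summand `t`, and lies in the ideals
  -- killing all the others.
  refine ⟨ofWedge K (g ⊗ₜ x), ?_, ?_⟩
  · rw [Wdeg_eq_map]
    exact ⟨_, tmul_mem_symPart hgq x, rfl⟩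
  · funext t'
    refine (PiMap_ofWedge K U _ t').trans ?_
    by_cases ht' : t' = t
    · subst ht'
      rw [LinearMap.single_apply, Pi.single_eq_same]
      refine (Submodule.Quotient.eq _).mpr ?_
      rw [LinearMap.baseChange_tmul, ← TensorProduct.sub_tmul, sub_add_cancel_left]
      have := smul_mem_rel (φ := proj (U t')) (Submodule.mkQ_surjective _) K
        (r := -h) (by rw [← hker]; exact neg_mem hh) (1 ⊗ₜ exteriorPower.map 2 (proj (U t')) x)
      rwa [TensorProduct.smul_tmul', smul_eq_mul, mul_one] at this
    · rw [LinearMap.single_apply, Pi.single_eq_of_ne ht']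
      refine (Submodule.Quotient.mk_eq_zero _).mpr ?_
      simp only [SetLike.mem_coe, Submodule.mem_iInf] at hg
      have := smul_mem_rel (φ := proj (U t')) (Submodule.mkQ_surjective _) K
        (r := g) (by rw [← hker]; exact hg t' (by simp [ht']))
        (1 ⊗ₜ exteriorPower.map 2 (proj (U t')) x)
      rwa [TensorProduct.smul_tmul', smul_eq_mul, mul_one] at this

end Surjectivity

/-! ### Comparison of `W̃_q` with `W_q` over the smaller symmetric algebra -/

section Dimension

variable {k : Type*} [Field k] {V V' : Type*} [AddCommGroup V] [Module k V]
  [AddCommGroup V'] [Module k V']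

/-- The homomorphism `Sym V → Sym V'` induced by a linear map. -/
noncomputable def symMap (φ : V →ₗ[k] V') : S k V →ₐ[k] S k V' :=
  SymmetricAlgebra.lift (SymmetricAlgebra.ι k V' ∘ₗ φ)

theorem symMap_ι (φ : V →ₗ[k] V') (v : V) :
    symMap φ (SymmetricAlgebra.ι k V v) = SymmetricAlgebra.ι k V' (φ v) :=
  SymmetricAlgebra.lift_ι_apply _ _

theorem symMap_symMap {φ : V →ₗ[k] V'} {σ : V' →ₗ[k] V} (hσ : φ ∘ₗ σ = LinearMap.id)
    (f : S k V') : symMap φ (symMap σ f) = f := by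
  have : (symMap φ).comp (symMap σ) = AlgHom.id k _ :=
    SymmetricAlgebra.algHom_ext (LinearMap.ext fun v => by
      simpa [symMap_ι] using congrArg (SymmetricAlgebra.ι k V') (LinearMap.congr_fun hσ v))
  exact DFunLike.congr_fun this f

/-- Modulo the ideal of `ker φ` the identity and `σ φ` are algebra maps that agree on linear forms.
-/
theorem sub_symMap_mem_linIdeal {φ : V →ₗ[k] V'} {σ : V' →ₗ[k] V} (hσ : φ ∘ₗ σ = LinearMap.id)
    (f : S k V) : f - symMap σ (symMap φ f) ∈ linIdeal k V (LinearMap.ker φ) := by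
  set q := Ideal.Quotient.mkₐ k (linIdeal k V (LinearMap.ker φ))
  have : q = q.comp ((symMap σ).comp (symMap φ)) := by
    refine SymmetricAlgebra.algHom_ext (LinearMap.ext fun v => Ideal.Quotient.eq.mpr ?_)
    change SymmetricAlgebra.ι k V v - symMap σ (symMap φ (SymmetricAlgebra.ι k V v)) ∈ _
    rw [symMap_ι, symMap_ι, ← map_sub]
    refine ι_mem_linIdeal ?_
    rw [LinearMap.mem_ker, map_sub]
    exact sub_eq_zero.mpr (LinearMap.congr_fun hσ (φ v)).symm
  exact Ideal.Quotient.eq.mp (DFunLike.congr_fun this f)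

theorem symMap_mem_symPow (φ : V →ₗ[k] V') {q : ℕ} {f : S k V} (hf : f ∈ symPow k V q) :
    symMap φ f ∈ symPow k V' q := by
  suffices h : symPow k V q ≤ (symPow k V' q).comap (symMap φ).toLinearMap from h hf
  clear hf
  induction q with
  | zero => exact symPow_zero_le (by simp [symPow])
  | succ q ih =>
    refine symPow_succ_le fun v f hf => ?_
    rw [Submodule.mem_comap, AlgHom.toLinearMap_apply, map_mul, symMap_ι]
    exact ι_mul_mem_symPow _ (ih hf)

/-- The map `M ⊗ Sym V → M ⊗ Sym V'` induced by a linear map `V → V'`. -/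
noncomputable def symTensor (φ : V →ₗ[k] V') (M : Type*) [AddCommGroup M] [Module k M] :
    S k V ⊗[k] M →ₗ[k] S k V' ⊗[k] M :=
  (symMap φ).toLinearMap.rTensor M

theorem symTensor_tmul (φ : V →ₗ[k] V') {M : Type*} [AddCommGroup M] [Module k M] (f : S k V)
    (m : M) : symTensor φ M (f ⊗ₜ m) = symMap φ f ⊗ₜ m := rfl

theorem map_symTensor_symPart {φ : V →ₗ[k] V'} (hφ : Function.Surjective φ) (M : Type*)
    [AddCommGroup M] [Module k M] (q : ℕ) :
    (symPart k V M q).map (symTensor φ M) = symPart k V' M q := by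
  obtain ⟨σ, hσ⟩ := φ.exists_rightInverse_of_surjective (LinearMap.range_eq_top.mpr hφ)
  apply le_antisymm
  · rw [Submodule.map_le_iff_le_comap]
    exact symPart_le fun f hf m => tmul_mem_symPart (symMap_mem_symPow φ hf) m
  · refine symPart_le fun f hf m => ⟨symMap σ f ⊗ₜ m,
      tmul_mem_symPart (symMap_mem_symPow σ hf) m, ?_⟩
    rw [symTensor_tmul, symMap_symMap hσ]

theorem finrank_map_eq_of_ker_eq {X Y Z : Type*} [AddCommGroup X] [Module k X] [AddCommGroup Y]
    [Module k Y] [AddCommGroup Z] [Module k Z] {A : X →ₗ[k] Y} {B : X →ₗ[k] Z}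
    (h : LinearMap.ker A = LinearMap.ker B) (N : Submodule k X) :
    Module.finrank k (N.map A) = Module.finrank k (N.map B) := by
  rw [← LinearMap.range_domRestrict, ← LinearMap.range_domRestrict,
    ← (A.domRestrict N).quotKerEquivRange.finrank_eq,
    ← (B.domRestrict N).quotKerEquivRange.finrank_eq]
  rw [LinearMap.ker_domRestrict, LinearMap.ker_domRestrict, h]

theorem symTensor_rel_le [CharZero k] [FiniteDimensional k V'] (φ : V →ₗ[k] V')
    (K : Submodule k (⋀[k]^2 V)) {x : S k V ⊗[k] (⋀[k]^2 V')} (hx : x ∈ rel φ K) :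
    ofWedge (K.map (exteriorPower.map 2 φ)) (symTensor φ _ x) = 0 := by
  obtain ⟨⟨y₁, y₂⟩, rfl⟩ := hx
  rw [LinearMap.comp_apply, presMap, LinearMap.coprod_apply, map_add, map_add, map_add]
  have h₁ : ofWedge (K.map (exteriorPower.map 2 φ))
      (symTensor φ _ ((exteriorPower.map 2 φ).baseChange (S k V) (d3 k V y₁))) = 0 := by
    induction y₁ using tmul_induction with
    | h0 => simp
    | hadd x y hx hy => simp only [map_add, hx, hy, add_zero]
    | hp f v =>
      have hv : v = ![v 0, v 1, v 2] := by ext i; fin_cases i <;> rfl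
      rw [hv, baseChange_map_d3, map_add, map_sub, symTensor_tmul, symTensor_tmul,
        symTensor_tmul, map_mul, map_mul, map_mul, symMap_ι, symMap_ι, symMap_ι,
        ← d3_tmul_wedge, ofWedge_d3]
  have h₂ : ofWedge (K.map (exteriorPower.map 2 φ)) (symTensor φ _
      ((exteriorPower.map 2 φ).baseChange (S k V) (K.subtype.baseChange (S k V) y₂))) = 0 := by
    induction y₂ with
    | zero => simp
    | add a b ha hb => simp only [map_add, ha, hb, add_zero]
    | tmul f x =>
      rw [LinearMap.baseChange_tmul, LinearMap.baseChange_tmul, symTensor_tmul]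
      exact ofWedge_tmul_of_mem _ ⟨x, x.2, rfl⟩
  rw [h₁, h₂, add_zero]

theorem symTensor_presMap_mem_rel {φ : V →ₗ[k] V'} {σ : V' →ₗ[k] V}
    (hσ : φ ∘ₗ σ = LinearMap.id) (K : Submodule k (⋀[k]^2 V)) (y) :
    symTensor σ _ (presMap (K.map (exteriorPower.map 2 φ)) y) ∈ rel φ K := by
  obtain ⟨y₁, y₂⟩ := y
  rw [presMap, LinearMap.coprod_apply, map_add]
  refine add_mem ?_ ?_
  · induction y₁ using tmul_induction with
    | h0 => simp
    | hadd x y hx hy => rw [map_add, map_add]; exact add_mem hx hy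
    | hp f v =>
      have hv : v = ![v 0, v 1, v 2] := by ext i; fin_cases i <;> rfl
      have hφσ : ∀ v, φ (σ v) = v := LinearMap.congr_fun hσ
      have := baseChange_d3_mem_rel φ K
        (symMap σ f ⊗ₜ exteriorPower.ιMulti k 3 ![σ (v 0), σ (v 1), σ (v 2)])
      rw [baseChange_map_d3, hφσ, hφσ, hφσ] at this
      rw [hv, d3_tmul_wedge, map_add, map_sub, symTensor_tmul, symTensor_tmul, symTensor_tmul,
        map_mul, map_mul, map_mul, symMap_ι, symMap_ι, symMap_ι]
      exact this
  · induction y₂ with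
    | zero => simp
    | add a b ha hb => rw [map_add, map_add]; exact add_mem ha hb
    | tmul f x =>
      obtain ⟨_, x, hx, rfl⟩ := x
      exact tmul_map_mem_rel φ _ hx

theorem sub_symTensor_mem_rel {φ : V →ₗ[k] V'} (hφ : Function.Surjective φ) {σ : V' →ₗ[k] V}
    (hσ : φ ∘ₗ σ = LinearMap.id) (K : Submodule k (⋀[k]^2 V)) (x : S k V ⊗[k] (⋀[k]^2 V')) :
    x - symTensor σ _ (symTensor φ _ x) ∈ rel φ K := by
  induction x with
  | zero => simp
  | add a b ha hb => rw [map_add, map_add, add_sub_add_comm]; exact add_mem ha hb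
  | tmul f y =>
    have := smul_mem_rel hφ K (sub_symMap_mem_linIdeal hσ f) (1 ⊗ₜ y)
    rw [TensorProduct.smul_tmul', smul_eq_mul, mul_one] at this
    rwa [symTensor_tmul, symTensor_tmul, ← TensorProduct.sub_tmul]

variable [CharZero k] [FiniteDimensional k V']

/-- Restricting scalars along `Sym V → Sym V'` sends relations to relations, and a section `σ` sends
them back. The round trip changes `x` only by elements of the ideal of `ker φ` times the module,
which are already relations. -/
theorem mem_rel_iff {φ : V →ₗ[k] V'} (hφ : Function.Surjective φ)
    (K : Submodule k (⋀[k]^2 V)) (x : S k V ⊗[k] (⋀[k]^2 V')) :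
    x ∈ rel φ K ↔ ofWedge (K.map (exteriorPower.map 2 φ)) (symTensor φ _ x) = 0 := by
  obtain ⟨σ, hσ⟩ := φ.exists_rightInverse_of_surjective (LinearMap.range_eq_top.mpr hφ)
  refine ⟨fun hx => symTensor_rel_le φ K hx, fun hx => ?_⟩
  rw [← LinearMap.mem_ker, ker_ofWedge] at hx
  obtain ⟨y, hy⟩ := hx
  have h := add_mem (sub_symTensor_mem_rel hφ hσ K x) (symTensor_presMap_mem_rel hσ K y)
  rwa [hy, sub_add_cancel] at h

/-- `W̃_q(V', K')` and `W_q(V', K')` have the same dimension. -/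
theorem finrank_WtildeDeg {φ : V →ₗ[k] V'} (hφ : Function.Surjective φ)
    (K : Submodule k (⋀[k]^2 V)) (q : ℕ) :
    Module.finrank k (WtildeDeg φ K q) =
      Module.finrank k (Wdeg (K.map (exteriorPower.map 2 φ)) q) := by
  have hW : Wdeg (K.map (exteriorPower.map 2 φ)) q = (symPart k V (⋀[k]^2 V') q).map
      ((ofWedge (K.map (exteriorPower.map 2 φ))).restrictScalars k ∘ₗ symTensor φ _) := by
    rw [Wdeg_eq_map, ← map_symTensor_symPart hφ, ← Submodule.map_comp]
  rw [hW]
  -- Both graded pieces are images of the same space `⋀² V' ⊗ Sym^q V`, under maps with equal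
  -- kernels.
  refine finrank_map_eq_of_ker_eq (Submodule.ext fun x => ?_) _
  exact (Submodule.Quotient.mk_eq_zero (rel φ K)).trans (mem_rel_iff hφ K x)

end Dimension

/-! ### Assembly of the isomorphism and the dimension formula -/

section Main

variable {k : Type*} [Field k] [CharZero k] {V : Type*} [AddCommGroup V] [Module k V]
  [FiniteDimensional k V]

instance finite_WtildeDeg {V' : Type*} [AddCommGroup V'] [Module k V'] [FiniteDimensional k V']
    (φ : V →ₗ[k] V') (K : Submodule k (⋀[k]^2 V)) (q : ℕ) :
    Module.Finite k (WtildeDeg φ K q) :=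
  Module.Finite.map (symPart k V (⋀[k]^2 V') q) _

theorem finrank_Wdeg_of_bijOn (K : Submodule k (⋀[k]^2 V)) {n : ℕ}
    (U : Fin n → Submodule k (Module.Dual k V)) {q : ℕ}
    (h : Set.BijOn (PiMap K U) (Wdeg K q : Set (W K))
      {w | ∀ t, w t ∈ WtildeDeg (proj (U t)) K q}) :
    Module.finrank k (Wdeg K q) = ∑ t, Module.finrank k (Wdeg (Kbar K (U t)) q) := by
  have hsum : ∑ t, Module.finrank k (Wdeg (Kbar K (U t)) q) =
      Module.finrank k ((t : Fin n) → WtildeDeg (proj (U t)) K q) := by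
    have : ∀ t, Module.Free k (WtildeDeg (proj (U t)) K q) := fun t =>
      Module.Free.of_divisionRing k _
    rw [Module.finrank_pi_fintype]
    exact Finset.sum_congr rfl fun t _ =>
      (finrank_WtildeDeg (φ := proj (U t)) (Submodule.mkQ_surjective _) K q).symm
  rw [hsum]
  let Φ : Wdeg K q →ₗ[k] ((t : Fin n) → WtildeDeg (proj (U t)) K q) :=
    LinearMap.pi fun t => ((LinearMap.proj t ∘ₗ (PiMap K U).restrictScalars k) ∘ₗ
      (Wdeg K q).subtype).codRestrict _ fun w => h.mapsTo w.2 t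
  refine (LinearEquiv.ofBijective Φ ⟨fun x y hxy => ?_, fun w => ?_⟩).finrank_eq
  · refine Subtype.ext (h.injOn x.2 y.2 (funext fun t => ?_))
    exact congrArg Subtype.val (congrFun hxy t)
  · obtain ⟨x, hx, hxw⟩ := h.surjOn (show (fun t => (w t : Wtilde (proj (U t)) K)) ∈ _ from
      fun t => (w t).2)
    exact ⟨⟨x, hx⟩, funext fun t => Subtype.ext (congrFun hxw t)⟩

theorem exists_bijOn_PiMap [IsAlgClosed k] (K : Submodule k (⋀[k]^2 V)) (hK : IsSeparable K)
    {n : ℕ} (U : Fin n → Submodule k (Module.Dual k V)) (hinj : Function.Injective U)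
    (hU : Set.range (fun t => (U t : Set (Module.Dual k V))) = components (resonance K)) :
    ∃ q₀ : ℕ, ∀ q ≥ q₀, Set.BijOn (PiMap K U) (Wdeg K q : Set (W K))
      {w | ∀ t, w t ∈ WtildeDeg (proj (U t)) K q} := by
  have hmem : ∀ t, (U t : Set (Module.Dual k V)) ∈ components (resonance K) :=
    fun t => hU ▸ Set.mem_range_self t
  have hsep : ∀ t, IsSeparableSubspace K (U t) := fun t => by
    obtain ⟨U', hU', hs⟩ := hK _ (hmem t)
    rwa [SetLike.coe_injective hU'] at hs
  have hcover : ∀ a ∈ resonance K, ∃ t, a ∈ U t := fun a ha => by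
    obtain ⟨Z, hZ, haZ⟩ := exists_mem_components _ ha
    rw [← hU] at hZ
    obtain ⟨t, rfl⟩ := hZ
    exact ⟨t, haZ⟩
  -- Components are maximal irreducible subsets, so neither of two distinct ones contains the other.
  have hdisj : ∀ t t', t ≠ t' → U t ⊓ U t' = ⊥ := fun t t' hne =>
    (hsep t').inf_eq_bot (hmem t).1.1 fun hle => hne (hinj (le_antisymm hle
      (SetLike.coe_subset_coe.mp ((hmem t).2 (hmem t').1 (SetLike.coe_subset_coe.mpr hle)))))
  obtain ⟨q₀, hq₀⟩ := exists_injOn_PiMap K U hsep hcover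
  exact ⟨max q₀ n, fun q hq => ⟨mapsTo_PiMap K U q, hq₀ q ((le_max_left _ _).trans hq),
    surjOn_PiMap K U hdisj ((le_max_right _ _).trans hq)⟩⟩

end Main

end Koszul

theorem theorem1p2 {k : Type*} [Field k] [IsAlgClosed k] [CharZero k]
    {V : Type*} [AddCommGroup V] [Module k V] [FiniteDimensional k V]
    (K : Submodule k (⋀[k]^2 V)) (hK : Koszul.IsSeparable K) :
    -- the resonance variety has finitely many irreducible components
    (Koszul.components (Koszul.resonance K)).Finite ∧
    -- for every enumeration `U 0, …, U (n - 1)` of the components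
    ∀ (n : ℕ) (U : Fin n → Submodule k (Module.Dual k V)), Function.Injective U →
      Set.range (fun t => (U t : Set (Module.Dual k V))) =
        Koszul.components (Koszul.resonance K) →
      (∃ q₀ : ℕ, ∀ q ≥ q₀,
        Set.BijOn (Koszul.PiMap K U) (Koszul.Wdeg K q : Set (Koszul.W K))
          {w | ∀ t, w t ∈ Koszul.WtildeDeg (Koszul.proj (U t)) K q}) ∧
      (∃ q₀ : ℕ, ∀ q ≥ q₀,
        Module.finrank k (Koszul.Wdeg K q) =
          ∑ t, Module.finrank k (Koszul.Wdeg (Koszul.Kbar K (U t)) q)) := by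
  refine ⟨Koszul.finite_components _, fun n U hinj hU => ?_⟩
  obtain ⟨q₀, hq₀⟩ := Koszul.exists_bijOn_PiMap K hK U hinj hU
  exact ⟨⟨q₀, hq₀⟩, q₀, fun q hq => Koszul.finrank_Wdeg_of_bijOn K U (hq₀ q hq)⟩
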